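/- **Corollary 4.8 (Hochster).** Let $K$ be a field, $n\ge 0$, and let $\Delta$ be a simplicial complex on $[n]=\{1,\dots,n\}$, i.e. a family of subsets of $[n]$ closed under taking subsets. Let $S=K[X_1,\dots,X_n]$ with its $\mathbb{N}^n$-grading in which $X_i$ has degree the $i$-th unit vector, let $I_\Delta=(\prod_{i\in F}X_i : F\subseteq[n],\ F\notin\Delta)$, and let $K[\Delta]=S/I_\Delta$ be the Stanley–Reisner ring with the induced $\mathbb{N}^n$-grading. Write $\mathfrak m=(X_1,\dots,X_n)$. Then $K[\Delta]$ has a minimal $\mathbb{N}^n$-graded free resolution, that is, an exact complex $$\cdots\to F_1\xrightarrow{\partial_1}F_0\xrightarrow{\partial_0}K[\Delta]\to 0$$ of homogeneous $S$-linear maps in which each $F_i=\bigoplus_{a\in\mathbb{N}^n}S(-a)^{\beta_{i,a}}$ is a finitely generated graded free $S$-module and $\operatorname{Ker}\partial_i\subseteq\mathfrak m F_i$ for all $i\ge 0$. Moreover, for every such resolution, every $i\ge 0$ and every $W\subseteq[n]$, the Betti number $\beta_{i,W}^S(K[\Delta])$, i.e. the exponent $\beta_{i,a}$ for the squarefree vector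 $a=\sum_{j\in W}\varepsilon_j$ with support $W$ (where $\varepsilon_j$ is the $j$-th unit vector), satisfies $$\beta_{i,W}^S(K[\Delta])=\dim_K\tilde H_{|W|-i-1}(\Delta_W),$$ where $\Delta_W=\{F\in\Delta : F\subseteq W\}$ and $\tilde H_j$, $j\in\mathbb{Z}$, denotes the $j$-th reduced simplicial homology with coefficients in $K$, i.e. the homology of the augmented oriented chain complex (in which the empty face has dimension $-1$; it is $0$ in degrees $j<-1$). -/

import Mathlib

/-- An (abstract) simplicial complex on `[n]`, modelled on `Fin n`: a family of subsets that is
closed under passing to subsets. The empty set is a face of dimension `-1`.  We do not insist that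
all singletons are faces (nor that the family is nonempty), so this covers every usual
convention. -/
structure VertexComplex (n : ℕ) where
  /-- the faces -/
  faces : Set (Finset (Fin n))
  down_closed : ∀ F ∈ faces, ∀ G, G ⊆ F → G ∈ faces

namespace VertexComplex

variable {n : ℕ}

/-- The restriction `Δ_W = {F ∈ Δ : F ⊆ W}`. -/
def restrict (Δ : VertexComplex n) (W : Finset (Fin n)) : VertexComplex n where
  faces := {F | F ∈ Δ.faces ∧ F ⊆ W}
  down_closed := fun F hF G hG => ⟨Δ.down_closed F hF.1 G hG, hG.trans hF.2⟩

/-- The Stanley–Reisner ideal, generated by the monomials `∏_{i ∈ F} X_i`, `F` not a face. -/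
noncomputable def stanleyReisnerIdeal (K : Type*) [Field K] (Δ : VertexComplex n) :
    Ideal (MvPolynomial (Fin n) K) :=
  Ideal.span {p | ∃ F : Finset (Fin n), F ∉ Δ.faces ∧ p = ∏ i ∈ F, MvPolynomial.X i}

/-- The Stanley–Reisner ring `K[Δ] = K[X_1, …, X_n] / I_Δ`. -/
abbrev StanleyReisnerRing (K : Type*) [Field K] (Δ : VertexComplex n) : Type _ :=
  MvPolynomial (Fin n) K ⧸ Δ.stanleyReisnerIdeal K

/-- The simplicial boundary map on formal combinations of subsets of `Fin n`
(functions `c : Finset (Fin n) → K`, standing for `∑_F c F · F`):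
`{e_0 < ⋯ < e_i} ↦ ∑_k (-1)^k {e_0, …, e_i} \ {e_k}`; in particular a singleton goes to the empty
set and the empty set to `0`. -/
noncomputable def boundary (K : Type*) [Field K] (n : ℕ) :
    (Finset (Fin n) → K) →ₗ[K] (Finset (Fin n) → K) :=
  Fintype.linearCombination K fun F : Finset (Fin n) =>
    ∑ e ∈ F, Pi.single (F.erase e) ((-1 : K) ^ (F.filter (· < e)).card)

/-- The chains of dimension `j` of the augmented oriented chain complex of `Δ`: the formal
`K`-combinations of faces of dimension `j`, i.e. with `j + 1` elements. -/
def chains (K : Type*) [Field K] (Δ : VertexComplex n) (j : ℤ) :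
    Submodule K (Finset (Fin n) → K) where
  carrier := {c | ∀ F, c F ≠ 0 → F ∈ Δ.faces ∧ (F.card : ℤ) = j + 1}
  zero_mem' := fun F h => absurd rfl h
  add_mem' := fun {a b} ha hb F h => by
    by_cases h0 : a F = 0
    · exact hb F fun h1 => h (by simp [h0, h1])
    · exact ha F h0
  smul_mem' := fun r a ha F h => ha F fun h0 => h (by simp [h0])

/-- The cycles of dimension `j`. -/
noncomputable def cycles (K : Type*) [Field K] (Δ : VertexComplex n) (j : ℤ) :
    Submodule K (Finset (Fin n) → K) :=
  Δ.chains K j ⊓ LinearMap.ker (boundary K n)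

/-- The boundaries of dimension `j`. -/
noncomputable def boundaries (K : Type*) [Field K] (Δ : VertexComplex n) (j : ℤ) :
    Submodule K (Finset (Fin n) → K) :=
  (Δ.chains K (j + 1)).map (boundary K n)

/-- The `j`-th reduced simplicial homology `H̃_j(Δ)` with coefficients in `K`, for `j : ℤ`. -/
abbrev ReducedHomology (K : Type*) [Field K] (Δ : VertexComplex n) (j : ℤ) : Type _ :=
  Δ.cycles K j ⧸ (Δ.boundaries K j).comap (Δ.cycles K j).subtype

end VertexComplex

/-! ### Graded free resolutions and Betti numbers over a graded `K`-algebra -/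

section Graded

variable {K H R M : Type*} [Field K] [AddCommMonoid H] [CommRing R] [Algebra K R]
  [AddCommGroup M] [Module K M] [Module R M]

/-- The degree `h` component of the graded free module `⨁_j R(-deg j)`, where
`R(-d)_h = ⨁_{g + d = h} R_g`. -/
def gradedFreeComponent (𝒜 : H → Submodule K R) {r : ℕ} (deg : Fin r → H) (h : H) :
    Submodule K (Fin r → R) :=
  Submodule.pi Set.univ fun j => ⨆ (g : H) (_ : g + deg j = h), 𝒜 g

/-- The graded maximal ideal `𝔪`, generated by the homogeneous elements of nonzero degree. -/
def gradedMaximalIdeal (𝒜 : H → Submodule K R) : Ideal R :=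
  Ideal.span {x | ∃ h : H, h ≠ 0 ∧ x ∈ 𝒜 h}

/-- An `H`-graded free resolution `⋯ → F_1 → F_0 → M → 0` by finitely generated graded free
modules `F_i = ⨁_j R(-deg i j)`; all maps are `R`-linear and homogeneous. Here `𝒜` and `ℳ` are the
gradings of `R` and of `M`. -/
structure GradedFreeResolution (𝒜 : H → Submodule K R) (ℳ : H → Submodule K M) where
  /-- the rank of `F_i` -/
  rank : ℕ → ℕ
  /-- the degrees of the standard generators of `F_i` -/
  deg : ∀ i, Fin (rank i) → H
  /-- the differential `F_{i+1} → F_i` -/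
  d : ∀ i, (Fin (rank (i + 1)) → R) →ₗ[R] (Fin (rank i) → R)
  /-- the augmentation `F_0 → M` -/
  aug : (Fin (rank 0) → R) →ₗ[R] M
  d_homogeneous : ∀ i h, ∀ x ∈ gradedFreeComponent 𝒜 (deg (i + 1)) h,
    d i x ∈ gradedFreeComponent 𝒜 (deg i) h
  aug_homogeneous : ∀ h, ∀ x ∈ gradedFreeComponent 𝒜 (deg 0) h, aug x ∈ ℳ h
  aug_surjective : Function.Surjective aug
  exact_zero : Function.Exact (d 0) aug
  exact_succ : ∀ i, Function.Exact (d (i + 1)) (d i)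

namespace GradedFreeResolution

variable {𝒜 : H → Submodule K R} {ℳ : H → Submodule K M}

/-- The resolution is minimal: `Ker ∂_i ⊆ 𝔪 F_i` for all `i`, where `∂_0` is the augmentation. -/
def IsMinimal (F : GradedFreeResolution 𝒜 ℳ) : Prop :=
  LinearMap.ker F.aug ≤ gradedMaximalIdeal 𝒜 • (⊤ : Submodule R (Fin (F.rank 0) → R)) ∧
  ∀ i, LinearMap.ker (F.d i) ≤
    gradedMaximalIdeal 𝒜 • (⊤ : Submodule R (Fin (F.rank (i + 1)) → R))

/-- The number of summands `R(-h)` in `F_i`.  If `F` is a minimal resolution of `M`, this is the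
graded Betti number `β_{i,h}^R(M)`. -/
noncomputable def betti (F : GradedFreeResolution 𝒜 ℳ) (i : ℕ) (h : H) : ℕ :=
  Nat.card {j : Fin (F.rank i) // F.deg i j = h}

end GradedFreeResolution

end Graded

/-- The fine `ℕ^n`-grading of `S = K[X_1, …, X_n]`, with `X_i` of degree the `i`-th unit vector. -/
noncomputable def fineGrading (K : Type*) [Field K] (n : ℕ) (a : Fin n →₀ ℕ) :
    Submodule K (MvPolynomial (Fin n) K) :=
  MvPolynomial.weightedHomogeneousSubmodule K (fun i : Fin n => Finsupp.single i 1) a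

/-- The induced `ℕ^n`-grading of the Stanley–Reisner ring: the image of the grading of `S`. -/
noncomputable def VertexComplex.ringGrading (K : Type*) [Field K] {n : ℕ} (Δ : VertexComplex n)
    (a : Fin n →₀ ℕ) : Submodule K (Δ.StanleyReisnerRing K) :=
  (fineGrading K n a).map (Ideal.Quotient.mkₐ K (Δ.stanleyReisnerIdeal K)).toLinearMap

/-- The squarefree vector in `ℕ^n` with support `W`. -/
noncomputable def squarefreeVector {n : ℕ} (W : Finset (Fin n)) : Fin n →₀ ℕ :=
  ∑ i ∈ W, Finsupp.single i 1

/-!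
The squarefree Betti numbers are computed by `Tor^S(K, K[Δ])`, and `Tor` by the Koszul complex of
`K[Δ]`. The argument below carries this out by hand, in multidegree `W` only.

For a multigraded module with components `𝒩 V` in the squarefree degrees, the part of multidegree
`W` of the Koszul complex consists of the families `c V ∈ 𝒩 V`, `V ⊆ W`; in exterior degree `p` the
support is restricted to `|V| = |W| - p`. Indexed by `q = |V|` it is a cochain complex with
`(δ c) V = ∑_{e ∈ V} ± X_e c(V \ e)`. Three facts give the theorem.

* For a graded free module the complex is exact except for the generators of degree exactly `W`,
  which contribute to `q = |W|` (`exists_koszulDiff_eq_of_free`): every other generator misses some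
  `e ∈ W`, and removing `e` is a contracting homotopy.
* If `f` maps a graded free module onto `𝒩` with kernel `Z ⊆ 𝔪 F`, then `H^q(𝒩)` and `H^{q+1}(Z)`
  have the same dimension for `q < |W|`, and `H^{|W|}(𝒩)` has the number of generators of degree `W`
  as its dimension (`finrank_koszulCohomology_of_cover`, `finrank_koszulCohomology_card_of_cover`).
  Climbing along a minimal resolution, `β_{i,W} = dim H^{|W|-i}(K[Δ])`.
* The squarefree part of `K[Δ]` has one basis vector for each face, and multiplication by `X_e` adds
  the vertex `e` if this yields a face. The Koszul complex of `K[Δ]` is therefore the transpose of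
  the augmented chain complex of `Δ_W` (`VertexComplex.koszulDiff_faceMonomials`), and a matrix and
  its transpose have the same rank.

A minimal resolution exists because a system of homogeneous generators of smallest possible size has
all of its relations in `𝔪 F` (`exists_minimal_cover`), and kernels of homogeneous maps are again
graded and finitely generated.
-/

/-! ### The fine grading in terms of coefficients -/

section FineGrading

variable {K : Type*} [Field K] {n : ℕ}

open MvPolynomial

theorem mem_fineGrading {a : Fin n →₀ ℕ} {p : MvPolynomial (Fin n) K} :
    p ∈ fineGrading K n a ↔ ∀ b, p.coeff b ≠ 0 → b = a := by
  have hw : ∀ b : Fin n →₀ ℕ, Finsupp.weight (fun i : Fin n => Finsupp.single i 1) b = b := by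
    intro b
    simp [Finsupp.weight_apply]
  rw [fineGrading, mem_weightedHomogeneousSubmodule]
  simp only [IsWeightedHomogeneous, hw]

theorem monomial_mem_fineGrading (a : Fin n →₀ ℕ) (c : K) : monomial a c ∈ fineGrading K n a := by
  classical
  rw [mem_fineGrading]
  intro b hb
  rw [coeff_monomial] at hb
  by_contra h
  exact hb (if_neg fun h' => h h'.symm)

theorem mem_gradedFreeComponent {r : ℕ} {deg : Fin r → Fin n →₀ ℕ} {h : Fin n →₀ ℕ}
    {x : Fin r → MvPolynomial (Fin n) K} :
    x ∈ gradedFreeComponent (fineGrading K n) deg h ↔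
      ∀ j a, (x j).coeff a ≠ 0 → a + deg j = h := by
  rw [gradedFreeComponent, Submodule.mem_pi]
  refine ⟨fun H j => ?_, fun H j _ => ?_⟩
  all_goals
    by_cases hg : ∃ g, g + deg j = h
    · obtain ⟨g, rfl⟩ := hg
      have hs : (⨆ (g' : Fin n →₀ ℕ) (_ : g' + deg j = g + deg j), fineGrading K n g') =
          fineGrading K n g := by
        refine le_antisymm (iSup₂_le fun g' h' => ?_) (le_iSup₂_of_le g rfl le_rfl)
        rw [add_right_cancel h']
      first
        | (have H' := H j (Set.mem_univ _)
           rw [hs, mem_fineGrading] at H'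
           intro a ha
           rw [H' a ha])
        | (rw [hs, mem_fineGrading]
           intro a ha
           exact add_right_cancel (H j a ha))
    · have hs : (⨆ (g' : Fin n →₀ ℕ) (_ : g' + deg j = h), fineGrading K n g') = ⊥ := by
        rw [eq_bot_iff]
        exact iSup₂_le fun g' h' => absurd ⟨g', h'⟩ hg
      first
        | (have H' := H j (Set.mem_univ _)
           rw [hs, Submodule.mem_bot] at H'
           intro a ha
           simp [H'] at ha)
        | (rw [hs, Submodule.mem_bot]
           ext a
           by_contra ha
           exact hg ⟨a, H j a (by simpa using ha)⟩)

theorem mem_gradedMaximalIdeal {p : MvPolynomial (Fin n) K} :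
    p ∈ gradedMaximalIdeal (fineGrading K n) ↔ p.coeff 0 = 0 := by
  constructor
  · intro hp
    have hle : gradedMaximalIdeal (fineGrading K n) ≤
        RingHom.ker (constantCoeff : MvPolynomial (Fin n) K →+* K) := by
      refine Ideal.span_le.2 ?_
      rintro x ⟨h, h0, hx⟩
      by_contra hne
      exact h0 (mem_fineGrading.1 hx 0 hne).symm
    exact hle hp
  · intro hp
    rw [← support_sum_monomial_coeff p]
    refine Ideal.sum_mem _ fun a ha => Ideal.subset_span ⟨a, ?_, monomial_mem_fineGrading _ _⟩
    rintro rfl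
    exact (mem_support_iff.1 ha) hp

theorem mem_gradedMaximalIdeal_smul_top {r : ℕ} {x : Fin r → MvPolynomial (Fin n) K} :
    x ∈ gradedMaximalIdeal (fineGrading K n) •
        (⊤ : Submodule (MvPolynomial (Fin n) K) (Fin r → MvPolynomial (Fin n) K)) ↔
      ∀ j, (x j).coeff 0 = 0 := by
  constructor
  · intro hx j
    rw [← mem_gradedMaximalIdeal]
    refine Submodule.smul_induction_on (p := fun x => x j ∈ gradedMaximalIdeal (fineGrading K n)) hx ?_ ?_
    · intro p hp y _
      exact Ideal.mul_mem_right _ _ hp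
    · intro y z hy hz
      exact Ideal.add_mem _ hy hz
  · intro hx
    rw [pi_eq_sum_univ' x]
    exact Submodule.sum_mem _ fun j _ =>
      Submodule.smul_mem_smul (mem_gradedMaximalIdeal.2 (hx j)) Submodule.mem_top

end FineGrading

/-! ### Graded vector spaces and their projections -/

section Projections

variable {K H P Q : Type*} [Field K] [AddCommGroup P] [Module K P] [AddCommGroup Q] [Module K Q]

/-- The family `ℳ` is a grading of the vector space `P`, with `π h` the projection of `P` onto the
summand `ℳ h` along all the others. -/
structure IsGradedBy (ℳ : H → Submodule K P) (π : H → P →ₗ[K] P) : Prop where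
  proj_mem : ∀ h x, π h x ∈ ℳ h
  proj_of_mem : ∀ h, ∀ x ∈ ℳ h, π h x = x
  proj_of_ne : ∀ g h, g ≠ h → ∀ x ∈ ℳ g, π h x = 0
  iSup_eq_top : ⨆ h, ℳ h = ⊤

variable {ℳ : H → Submodule K P} {π : H → P →ₗ[K] P}
  {𝒬 : H → Submodule K Q} {ρ : H → Q →ₗ[K] Q}

theorem IsGradedBy.map_proj (hM : IsGradedBy ℳ π) (hQ : IsGradedBy 𝒬 ρ) (f : P →ₗ[K] Q)
    (hf : ∀ h, ∀ x ∈ ℳ h, f x ∈ 𝒬 h) (h : H) (x : P) : f (π h x) = ρ h (f x) := by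
  have hx : x ∈ ⨆ h, ℳ h := hM.iSup_eq_top ▸ Submodule.mem_top
  refine Submodule.iSup_induction _ (motive := fun x => f (π h x) = ρ h (f x)) hx
    (fun g y hy => ?_) (by simp) fun y z hy hz => by simp only [map_add, hy, hz]
  by_cases hgh : g = h
  · subst hgh
    rw [hM.proj_of_mem _ _ hy, hQ.proj_of_mem _ _ (hf _ _ hy)]
  · rw [hM.proj_of_ne _ _ hgh _ hy, hQ.proj_of_ne _ _ hgh _ (hf _ _ hy), map_zero]

/-- Every vector is a finite sum of its homogeneous components. -/
theorem IsGradedBy.exists_sum_proj (hM : IsGradedBy ℳ π) (x : P) :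
    ∃ T : Finset H, x = ∑ h ∈ T, π h x := by
  classical
  have hx : x ∈ ⨆ h, ℳ h := hM.iSup_eq_top ▸ Submodule.mem_top
  obtain ⟨f, hf, rfl⟩ := (Submodule.mem_iSup_iff_exists_finsupp _ _).1 hx
  refine ⟨f.support, Finset.sum_congr rfl fun h hh => ?_⟩
  rw [Finsupp.sum, map_sum, Finset.sum_eq_single h]
  · exact (hM.proj_of_mem _ _ (hf h)).symm
  · intro g _ hg
    exact hM.proj_of_ne _ _ hg _ (hf g)
  · intro hn
    exact absurd hh hn

/-- A homogeneous element in the image of a homogeneous map lifts to a homogeneous element. -/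
theorem IsGradedBy.exists_mem_of_mem_range (hM : IsGradedBy ℳ π) (hQ : IsGradedBy 𝒬 ρ)
    (f : P →ₗ[K] Q) (hf : ∀ h, ∀ x ∈ ℳ h, f x ∈ 𝒬 h) {h : H} {y : Q} (hy : y ∈ 𝒬 h)
    (hr : ∃ x, f x = y) : ∃ x ∈ ℳ h, f x = y := by
  obtain ⟨x, rfl⟩ := hr
  exact ⟨π h x, hM.proj_mem _ _, by rw [hM.map_proj hQ f hf, hQ.proj_of_mem _ _ hy]⟩

end Projections

section Free

variable {K : Type*} [Field K] {n r : ℕ}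

open MvPolynomial

/-- The projection of the graded free module `⨁_j S(-deg j)` onto its component of degree `h`. -/
noncomputable def freeProj (K : Type*) [Field K] {n r : ℕ} (deg : Fin r → Fin n →₀ ℕ)
    (h : Fin n →₀ ℕ) :
    (Fin r → MvPolynomial (Fin n) K) →ₗ[K] (Fin r → MvPolynomial (Fin n) K) :=
  LinearMap.pi fun j =>
    if deg j ≤ h then
      monomial (h - deg j) ∘ₗ lcoeff K (h - deg j) ∘ₗ LinearMap.proj j
    else 0

theorem coeff_freeProj (deg : Fin r → Fin n →₀ ℕ) (h : Fin n →₀ ℕ)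
    (x : Fin r → MvPolynomial (Fin n) K) (j : Fin r) (a : Fin n →₀ ℕ) :
    (freeProj K deg h x j).coeff a = if a + deg j = h then (x j).coeff a else 0 := by
  classical
  by_cases hd : deg j ≤ h
  · have : a + deg j = h ↔ h - deg j = a := by
      rw [← eq_tsub_iff_add_eq_of_le hd, eq_comm]
    simp only [freeProj, LinearMap.pi_apply, if_pos hd, LinearMap.comp_apply, LinearMap.proj_apply,
      lcoeff_apply, coeff_monomial, this]
    split_ifs with h1
    · rw [h1]
    · rfl
  · have : ¬ a + deg j = h := fun h' => hd (h' ▸ le_add_self)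
    simp [freeProj, hd, this]

theorem isGradedBy_free (deg : Fin r → Fin n →₀ ℕ) :
    IsGradedBy (gradedFreeComponent (fineGrading K n) deg) (freeProj K deg) where
  proj_mem h x := by
    rw [mem_gradedFreeComponent]
    intro j a ha
    rw [coeff_freeProj] at ha
    by_contra hne
    exact ha (if_neg hne)
  proj_of_mem h x hx := by
    rw [mem_gradedFreeComponent] at hx
    ext j a
    rw [coeff_freeProj]
    split_ifs with hh
    · rfl
    · by_contra hne
      exact hh (hx j a fun h0 => hne h0.symm)
  proj_of_ne g h hgh x hx := by
    rw [mem_gradedFreeComponent] at hx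
    ext j a
    rw [coeff_freeProj]
    split_ifs with hh
    · by_contra hne
      exact hgh ((hx j a hne).symm.trans hh)
    · rfl
  iSup_eq_top := by
    classical
    rw [eq_top_iff]
    intro x _
    rw [← Finset.univ_sum_single x]
    refine Submodule.sum_mem _ fun j _ => ?_
    rw [← support_sum_monomial_coeff (x j)]
    have : (Pi.single j (∑ v ∈ (x j).support, monomial v (coeff v (x j))) :
        Fin r → MvPolynomial (Fin n) K) =
        ∑ v ∈ (x j).support, Pi.single j (monomial v (coeff v (x j))) := by
      exact map_sum (LinearMap.single K (fun _ : Fin r => MvPolynomial (Fin n) K) j) _ _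
    rw [this]
    refine Submodule.sum_mem _ fun v _ => Submodule.mem_iSup_of_mem (v + deg j) ?_
    rw [mem_gradedFreeComponent]
    intro k a ha
    by_cases hk : k = j
    · subst hk
      rw [Pi.single_eq_same, coeff_monomial] at ha
      have : v = a := by
        by_contra hne
        exact ha (if_neg hne)
      rw [this]
    · simp [Pi.single_eq_of_ne hk] at ha

/-- A homogeneous combination of homogeneous elements of a graded module is homogeneous. -/
theorem smul_mem_of_homogeneous {P : Type*} [AddCommGroup P] [Module K P]
    [Module (MvPolynomial (Fin n) K) P]
    {ℳ : (Fin n →₀ ℕ) → Submodule K P}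
    (hsmul : ∀ a (c : K) h, ∀ x ∈ ℳ h, (monomial a c : MvPolynomial (Fin n) K) • x ∈ ℳ (a + h))
    {p : MvPolynomial (Fin n) K} {d h : Fin n →₀ ℕ} (hp : ∀ a, p.coeff a ≠ 0 → a + d = h)
    {x : P} (hx : x ∈ ℳ d) : p • x ∈ ℳ h := by
  rw [← support_sum_monomial_coeff p, Finset.sum_smul]
  refine Submodule.sum_mem _ fun a ha => ?_
  rw [← hp a (mem_support_iff.1 ha)]
  exact hsmul _ _ _ _ hx

theorem monomial_smul_mem_free (deg : Fin r → Fin n →₀ ℕ) (a : Fin n →₀ ℕ) (c : K)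
    (h : Fin n →₀ ℕ) (x : Fin r → MvPolynomial (Fin n) K)
    (hx : x ∈ gradedFreeComponent (fineGrading K n) deg h) :
    (monomial a c : MvPolynomial (Fin n) K) • x ∈
      gradedFreeComponent (fineGrading K n) deg (a + h) := by
  classical
  rw [mem_gradedFreeComponent] at hx ⊢
  intro j b hb
  rw [Pi.smul_apply, smul_eq_mul, coeff_monomial_mul'] at hb
  split_ifs at hb with hab
  · rw [← hx j (b - a) (right_ne_zero_of_mul hb), ← add_assoc, add_tsub_cancel_of_le hab]
  · exact absurd rfl hb

end Free

/-! ### The Stanley–Reisner ring -/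

section StanleyReisner

variable {K : Type*} [Field K] {n : ℕ}

open MvPolynomial

theorem squarefreeVector_apply (W : Finset (Fin n)) (i : Fin n) :
    squarefreeVector W i = if i ∈ W then 1 else 0 := by
  classical
  simp [squarefreeVector, Finsupp.finsetSum_apply, Finsupp.single_apply]

theorem squarefreeVector_le_iff {V W : Finset (Fin n)} :
    squarefreeVector V ≤ squarefreeVector W ↔ V ⊆ W := by
  constructor
  · intro h i hi
    have := h i
    rw [squarefreeVector_apply, squarefreeVector_apply, if_pos hi] at this
    by_contra hW
    rw [if_neg hW] at this
    omega
  · intro h i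
    rw [squarefreeVector_apply, squarefreeVector_apply]
    by_cases hi : i ∈ V
    · rw [if_pos hi, if_pos (h hi)]
    · rw [if_neg hi]
      exact Nat.zero_le _

theorem single_add_squarefreeVector_erase {V : Finset (Fin n)} {e : Fin n} (he : e ∈ V) :
    Finsupp.single e 1 + squarefreeVector (V.erase e) = squarefreeVector V :=
  Finset.add_sum_erase V (fun i => Finsupp.single i 1) he

theorem prod_X_eq_monomial (F : Finset (Fin n)) :
    (∏ i ∈ F, X i : MvPolynomial (Fin n) K) = monomial (squarefreeVector F) 1 := by
  rw [squarefreeVector, monomial_sum_one]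
  rfl

namespace VertexComplex

theorem mem_stanleyReisnerIdeal {Δ : VertexComplex n} {p : MvPolynomial (Fin n) K} :
    p ∈ Δ.stanleyReisnerIdeal K ↔
      ∀ a, p.coeff a ≠ 0 → ∃ F, F ∉ Δ.faces ∧ squarefreeVector F ≤ a := by
  have hset : {p : MvPolynomial (Fin n) K | ∃ F : Finset (Fin n), F ∉ Δ.faces ∧ p = ∏ i ∈ F, X i} =
      (fun s => monomial s (1 : K)) '' {s | ∃ F, F ∉ Δ.faces ∧ squarefreeVector F = s} := by
    ext p
    constructor
    · rintro ⟨F, hF, rfl⟩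
      exact ⟨_, ⟨F, hF, rfl⟩, (prod_X_eq_monomial F).symm⟩
    · rintro ⟨_, ⟨F, hF, rfl⟩, rfl⟩
      exact ⟨F, hF, (prod_X_eq_monomial F).symm⟩
  rw [stanleyReisnerIdeal, hset, mem_ideal_span_monomial_image]
  constructor
  · intro h a ha
    obtain ⟨_, ⟨F, hF, rfl⟩, hle⟩ := h a (mem_support_iff.2 ha)
    exact ⟨F, hF, hle⟩
  · intro h a ha
    obtain ⟨F, hF, hle⟩ := h a (mem_support_iff.1 ha)
    exact ⟨_, ⟨F, hF, rfl⟩, hle⟩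

/-- The projection of `K[Δ]` onto its component of degree `a`; it is well defined because `I_Δ` is
spanned by monomials. -/
noncomputable def ringProj (K : Type*) [Field K] (Δ : VertexComplex n) (a : Fin n →₀ ℕ) :
    Δ.StanleyReisnerRing K →ₗ[K] Δ.StanleyReisnerRing K :=
  (Submodule.Quotient.restrictScalarsEquiv K (Δ.stanleyReisnerIdeal K)).toLinearMap ∘ₗ
    Submodule.mapQ ((Δ.stanleyReisnerIdeal K).restrictScalars K)
      ((Δ.stanleyReisnerIdeal K).restrictScalars K) (monomial a ∘ₗ lcoeff K a) (by
        classical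
        intro p hp
        change monomial a (coeff a p) ∈ Δ.stanleyReisnerIdeal K
        have hp' : p ∈ Δ.stanleyReisnerIdeal K := hp
        rw [mem_stanleyReisnerIdeal] at hp' ⊢
        intro b hb
        rw [coeff_monomial] at hb
        split_ifs at hb with hab
        · exact hab ▸ hp' a hb
        · exact absurd rfl hb) ∘ₗ
    (Submodule.Quotient.restrictScalarsEquiv K (Δ.stanleyReisnerIdeal K)).symm.toLinearMap

theorem ringProj_mk (Δ : VertexComplex n) (a : Fin n →₀ ℕ) (p : MvPolynomial (Fin n) K) :
    Δ.ringProj K a (Ideal.Quotient.mk _ p) = Ideal.Quotient.mk _ (monomial a (coeff a p)) :=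
  rfl

theorem mem_ringGrading {Δ : VertexComplex n} {a : Fin n →₀ ℕ} {x : Δ.StanleyReisnerRing K} :
    x ∈ Δ.ringGrading K a ↔ ∃ c : K, Ideal.Quotient.mk _ (monomial a c) = x := by
  classical
  constructor
  · rintro ⟨p, hp, rfl⟩
    refine ⟨coeff a p, ?_⟩
    have : monomial a (coeff a p) = p := by
      ext b
      rw [coeff_monomial]
      split_ifs with hab
      · rw [hab]
      · by_contra hne
        exact hab (mem_fineGrading.1 hp b fun h0 => hne h0.symm).symm
    rw [this]
    rfl
  · rintro ⟨c, rfl⟩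
    exact ⟨_, monomial_mem_fineGrading _ _, rfl⟩

theorem isGradedBy_ring (Δ : VertexComplex n) : IsGradedBy (Δ.ringGrading K) (Δ.ringProj K) where
  proj_mem h x := by
    obtain ⟨p, rfl⟩ := Ideal.Quotient.mk_surjective x
    exact mem_ringGrading.2 ⟨_, rfl⟩
  proj_of_mem h x hx := by
    classical
    obtain ⟨c, rfl⟩ := mem_ringGrading.1 hx
    rw [ringProj_mk, coeff_monomial, if_pos rfl]
  proj_of_ne g h hgh x hx := by
    classical
    obtain ⟨c, rfl⟩ := mem_ringGrading.1 hx
    rw [ringProj_mk, coeff_monomial, if_neg hgh, map_zero, map_zero]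
  iSup_eq_top := by
    rw [eq_top_iff]
    intro x _
    obtain ⟨p, rfl⟩ := Ideal.Quotient.mk_surjective x
    rw [← support_sum_monomial_coeff p, map_sum]
    exact Submodule.sum_mem _ fun a _ => Submodule.mem_iSup_of_mem a (mem_ringGrading.2 ⟨_, rfl⟩)

theorem monomial_smul_mem_ringGrading (Δ : VertexComplex n) (a : Fin n →₀ ℕ) (c : K)
    (h : Fin n →₀ ℕ) (x : Δ.StanleyReisnerRing K) (hx : x ∈ Δ.ringGrading K h) :
    (monomial a c : MvPolynomial (Fin n) K) • x ∈ Δ.ringGrading K (a + h) := by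
  obtain ⟨d, rfl⟩ := mem_ringGrading.1 hx
  refine mem_ringGrading.2 ⟨c * d, ?_⟩
  rw [← monomial_mul, map_mul]
  rfl

end VertexComplex

end StanleyReisner

/-! ### Existence of minimal graded free resolutions -/

section Existence

variable {K : Type*} [Field K] {n : ℕ}

open MvPolynomial

/-- A graded submodule `N` of a Noetherian graded module is the image of a homogeneous map from a
graded free module whose kernel lies in `𝔪 F`: a system of homogeneous generators of smallest
possible size has no relation with an invertible coefficient. -/
theorem exists_minimal_cover {P : Type*} [AddCommGroup P] [Module K P]
    [Module (MvPolynomial (Fin n) K) P] [IsScalarTower K (MvPolynomial (Fin n) K) P]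
    [IsNoetherian (MvPolynomial (Fin n) K) P]
    {ℳ : (Fin n →₀ ℕ) → Submodule K P} {π : (Fin n →₀ ℕ) → P →ₗ[K] P} (hM : IsGradedBy ℳ π)
    (hsmul : ∀ a (c : K) h, ∀ x ∈ ℳ h, (monomial a c : MvPolynomial (Fin n) K) • x ∈ ℳ (a + h))
    (N : Submodule (MvPolynomial (Fin n) K) P) (hN : ∀ x ∈ N, ∀ h, π h x ∈ N) :
    ∃ (r : ℕ) (deg : Fin r → Fin n →₀ ℕ)
      (f : (Fin r → MvPolynomial (Fin n) K) →ₗ[MvPolynomial (Fin n) K] P),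
      LinearMap.range f = N ∧
      (∀ h, ∀ x ∈ gradedFreeComponent (fineGrading K n) deg h, f x ∈ ℳ h) ∧
      LinearMap.ker f ≤ gradedMaximalIdeal (fineGrading K n) • ⊤ := by
  classical
  have hex : ∃ r : ℕ, ∃ (deg : Fin r → Fin n →₀ ℕ) (g : Fin r → P), (∀ j, g j ∈ ℳ (deg j)) ∧
      Submodule.span (MvPolynomial (Fin n) K) (Set.range g) = N := by
    have hspan : Submodule.span (MvPolynomial (Fin n) K) {x | x ∈ N ∧ ∃ h, x ∈ ℳ h} = N := by
      refine le_antisymm (Submodule.span_le.2 fun x hx => hx.1) fun x hx => ?_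
      obtain ⟨T, hT⟩ := hM.exists_sum_proj x
      rw [hT]
      exact Submodule.sum_mem _ fun h _ =>
        Submodule.subset_span ⟨hN x hx h, h, hM.proj_mem h x⟩
    have hfg := IsNoetherian.noetherian N
    rw [← hspan, Submodule.fg_span_iff_fg_span_finset_subset] at hfg
    obtain ⟨s, hs, hsp⟩ := hfg
    choose deg hdeg using fun x : s => (hs x.2).2
    refine ⟨s.card, fun j => deg (s.equivFin.symm j), fun j => s.equivFin.symm j,
      fun j => hdeg _, ?_⟩
    rw [← hspan, hsp]
    congr 1
    ext x
    constructor
    · rintro ⟨j, rfl⟩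
      exact (s.equivFin.symm j).2
    · intro hx
      exact ⟨s.equivFin ⟨x, hx⟩, by simp⟩
  obtain ⟨deg, g, hg, hgN⟩ := Nat.find_spec hex
  have hmin := fun m => Nat.find_min hex (m := m)
  generalize Nat.find hex = r at deg g hg hgN hmin
  have hhom : ∀ h, ∀ x ∈ gradedFreeComponent (fineGrading K n) deg h,
      Fintype.linearCombination (MvPolynomial (Fin n) K) g x ∈ ℳ h := by
    intro h x hx
    rw [Fintype.linearCombination_apply]
    rw [mem_gradedFreeComponent] at hx
    exact Submodule.sum_mem _ fun j _ => smul_mem_of_homogeneous hsmul (hx j) (hg j)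
  refine ⟨r, deg, Fintype.linearCombination _ g, ?_, hhom, ?_⟩
  · rw [Fintype.range_linearCombination, hgN]
  intro x hx
  rw [mem_gradedMaximalIdeal_smul_top]
  by_contra! hcon
  obtain ⟨j₀, hj₀⟩ := hcon
  -- The component of degree `deg j₀` of the relation `x` is a relation in which the coefficient
  -- of `g j₀` is a nonzero constant, so that `g j₀` is superfluous.
  set y := freeProj K deg (deg j₀) x with hy
  have hfy : Fintype.linearCombination (MvPolynomial (Fin n) K) g y = 0 := by
    have := (isGradedBy_free deg).map_proj hM
      ((Fintype.linearCombination (MvPolynomial (Fin n) K) g).restrictScalars K) hhom (deg j₀) x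
    have hx' : Fintype.linearCombination (MvPolynomial (Fin n) K) g x = 0 := hx
    simpa [hx'] using this
  have hyj : y j₀ = C (coeff 0 (x j₀)) := by
    ext a
    rw [hy, coeff_freeProj, coeff_C]
    by_cases ha : 0 = a
    · subst ha
      simp
    · have : ¬ a + deg j₀ = deg j₀ := fun h' => ha ((by simpa using h' : a = 0).symm)
      rw [if_neg this, if_neg ha]
  obtain _ | m := r
  · exact j₀.elim0
  refine hmin m (Nat.lt_succ_self m) ⟨fun k => deg (j₀.succAbove k), fun k => g (j₀.succAbove k),
    fun k => hg _, ?_⟩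
  rw [← hgN]
  refine le_antisymm (Submodule.span_mono ?_) (Submodule.span_le.2 ?_)
  · rintro _ ⟨k, rfl⟩
    exact ⟨_, rfl⟩
  · have hsucc : ∀ k, g (j₀.succAbove k) ∈ Submodule.span (MvPolynomial (Fin n) K)
        (Set.range fun k => g (j₀.succAbove k)) := fun k => Submodule.subset_span ⟨k, rfl⟩
    rintro _ ⟨j, rfl⟩
    obtain rfl | ⟨k, rfl⟩ := Fin.eq_self_or_eq_succAbove j₀ j
    · rw [Fintype.linearCombination_apply, Fin.sum_univ_succAbove _ j, hyj] at hfy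
      have h1 : g j = (C (coeff 0 (x j))⁻¹ : MvPolynomial (Fin n) K) •
          ((C (coeff 0 (x j)) : MvPolynomial (Fin n) K) • g j) := by
        rw [smul_smul, ← C_mul, inv_mul_cancel₀ hj₀, C_1, one_smul]
      rw [SetLike.mem_coe, h1, eq_neg_of_add_eq_zero_left hfy]
      exact Submodule.smul_mem _ _ (Submodule.neg_mem _
        (Submodule.sum_mem _ fun k _ => Submodule.smul_mem _ _ (hsucc k)))
    · exact hsucc k

/-- A graded free module together with a graded submodule: the submodule of relations from which
the next step of a resolution is built. -/
structure GradedSyzygy (K : Type*) [Field K] (n : ℕ) where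
  /-- the rank of the free module -/
  rank : ℕ
  /-- the degrees of its standard generators -/
  deg : Fin rank → Fin n →₀ ℕ
  /-- the graded submodule -/
  sub : Submodule (MvPolynomial (Fin n) K) (Fin rank → MvPolynomial (Fin n) K)
  proj_mem : ∀ x ∈ sub, ∀ h, freeProj K deg h x ∈ sub

/-- The kernel of a homogeneous map out of a graded free module, as a graded submodule. -/
noncomputable def GradedSyzygy.ofKer {P : Type*} [AddCommGroup P] [Module K P]
    [Module (MvPolynomial (Fin n) K) P] [IsScalarTower K (MvPolynomial (Fin n) K) P]
    {ℳ : (Fin n →₀ ℕ) → Submodule K P} {π : (Fin n →₀ ℕ) → P →ₗ[K] P} (hM : IsGradedBy ℳ π)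
    {r : ℕ} (deg : Fin r → Fin n →₀ ℕ)
    (f : (Fin r → MvPolynomial (Fin n) K) →ₗ[MvPolynomial (Fin n) K] P)
    (hf : ∀ h, ∀ x ∈ gradedFreeComponent (fineGrading K n) deg h, f x ∈ ℳ h) :
    GradedSyzygy K n where
  rank := r
  deg := deg
  sub := LinearMap.ker f
  proj_mem x hx h := by
    have := (isGradedBy_free deg).map_proj hM (f.restrictScalars K) hf h x
    have hx' : f x = 0 := hx
    rw [LinearMap.mem_ker]
    simpa [hx'] using this

theorem GradedSyzygy.exists_next (Z : GradedSyzygy K n) :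
    ∃ (Y : GradedSyzygy K n)
      (f : (Fin Y.rank → MvPolynomial (Fin n) K) →ₗ[MvPolynomial (Fin n) K]
        (Fin Z.rank → MvPolynomial (Fin n) K)),
      LinearMap.range f = Z.sub ∧ LinearMap.ker f = Y.sub ∧
      (∀ h, ∀ x ∈ gradedFreeComponent (fineGrading K n) Y.deg h,
        f x ∈ gradedFreeComponent (fineGrading K n) Z.deg h) ∧
      Y.sub ≤ gradedMaximalIdeal (fineGrading K n) • ⊤ := by
  obtain ⟨r, deg, f, hr, hf, hk⟩ := exists_minimal_cover (isGradedBy_free Z.deg)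
    (monomial_smul_mem_free Z.deg) Z.sub Z.proj_mem
  exact ⟨.ofKer (isGradedBy_free Z.deg) deg f hf, f, hr, rfl, hf, hk⟩

theorem GradedSyzygy.exists_resolution (Z₀ : GradedSyzygy K n) :
    ∃ Z : ℕ → GradedSyzygy K n, Z 0 = Z₀ ∧
      ∃ d : ∀ i, (Fin (Z (i + 1)).rank → MvPolynomial (Fin n) K) →ₗ[MvPolynomial (Fin n) K]
          (Fin (Z i).rank → MvPolynomial (Fin n) K),
        (∀ i, LinearMap.range (d i) = (Z i).sub) ∧ (∀ i, LinearMap.ker (d i) = (Z (i + 1)).sub) ∧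
        (∀ i h, ∀ x ∈ gradedFreeComponent (fineGrading K n) (Z (i + 1)).deg h,
          d i x ∈ gradedFreeComponent (fineGrading K n) (Z i).deg h) ∧
        ∀ i, (Z (i + 1)).sub ≤ gradedMaximalIdeal (fineGrading K n) • ⊤ := by
  choose next f hrange hkerf hf hmin using GradedSyzygy.exists_next (K := K) (n := n)
  let Z : ℕ → GradedSyzygy K n := fun i => Nat.rec Z₀ (fun _ Y => next Y) i
  exact ⟨Z, rfl, fun i => f (Z i), fun i => hrange (Z i), fun i => hkerf (Z i),
    fun i => hf (Z i), fun i => hmin (Z i)⟩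

theorem VertexComplex.exists_minimal_resolution (Δ : VertexComplex n) :
    ∃ F : GradedFreeResolution (fineGrading K n) (Δ.ringGrading K), F.IsMinimal := by
  have : IsNoetherian (MvPolynomial (Fin n) K) (Δ.StanleyReisnerRing K) := inferInstance
  obtain ⟨Z₀, aug, haug, hker, hhom, hmin⟩ : ∃ (Z₀ : GradedSyzygy K n)
      (aug : (Fin Z₀.rank → MvPolynomial (Fin n) K) →ₗ[MvPolynomial (Fin n) K]
        Δ.StanleyReisnerRing K),
      LinearMap.range aug = ⊤ ∧ LinearMap.ker aug = Z₀.sub ∧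
      (∀ h, ∀ x ∈ gradedFreeComponent (fineGrading K n) Z₀.deg h, aug x ∈ Δ.ringGrading K h) ∧
      Z₀.sub ≤ gradedMaximalIdeal (fineGrading K n) • ⊤ := by
    obtain ⟨r, deg, aug, haug, hhom, hker⟩ := exists_minimal_cover (Δ.isGradedBy_ring (K := K))
      Δ.monomial_smul_mem_ringGrading ⊤ fun _ _ _ => Submodule.mem_top
    exact ⟨.ofKer Δ.isGradedBy_ring deg aug hhom, aug, haug, rfl, hhom, hker⟩
  obtain ⟨Z, rfl, d, hrange, hkerd, hd, hdmin⟩ := Z₀.exists_resolution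
  exact ⟨{ rank := fun i => (Z i).rank
           deg := fun i => (Z i).deg
           d := d
           aug := aug
           d_homogeneous := hd
           aug_homogeneous := hhom
           aug_surjective := LinearMap.range_eq_top.1 haug
           exact_zero := LinearMap.exact_iff.2 (hker.trans (hrange 0).symm)
           exact_succ := fun i => LinearMap.exact_iff.2
             ((hkerd i).trans (hrange (i + 1)).symm) },
    hker.trans_le hmin, fun i => (hkerd i).trans_le (hdmin i)⟩

end Existence

/-! ### The Koszul differential on multigraded modules -/

section Koszul

variable {K : Type*} [Field K] {n : ℕ}

open MvPolynomial

theorem filter_lt_erase_of_lt {V : Finset (Fin n)} {e f : Fin n} (h : f < e) :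
    (V.erase e).filter (· < f) = V.filter (· < f) := by
  ext i
  simp only [Finset.mem_filter, Finset.mem_erase]
  exact ⟨fun H => ⟨H.1.2, H.2⟩, fun H => ⟨⟨(H.2.trans h).ne, H.1⟩, H.2⟩⟩

theorem card_filter_lt_erase_add_one {V : Finset (Fin n)} {e f : Fin n} (hf : f ∈ V) (h : f < e) :
    ((V.erase f).filter (· < e)).card + 1 = (V.filter (· < e)).card := by
  rw [Finset.filter_erase]
  exact Finset.card_erase_add_one (Finset.mem_filter.2 ⟨hf, h⟩)

/-- Removing two vertices from an oriented simplex in either order gives opposite signs. -/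
theorem sign_mul_sign_erase {V : Finset (Fin n)} {e f : Fin n} (he : e ∈ V) (hf : f ∈ V)
    (hef : e ≠ f) :
    (-1 : K) ^ (V.filter (· < e)).card * (-1) ^ ((V.erase e).filter (· < f)).card =
      -((-1) ^ (V.filter (· < f)).card * (-1) ^ ((V.erase f).filter (· < e)).card) := by
  rcases lt_or_gt_of_ne hef with h | h
  · rw [filter_lt_erase_of_lt h, ← card_filter_lt_erase_add_one he h, pow_succ]
    ring
  · rw [filter_lt_erase_of_lt h, ← card_filter_lt_erase_add_one hf h, pow_succ]
    ring

section Module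

variable {P : Type*} [AddCommGroup P] [Module K P] [Module (MvPolynomial (Fin n) K) P]
  [IsScalarTower K (MvPolynomial (Fin n) K) P]

/-- The Koszul differential of an `S`-module `P` relative to the variables `X_e`, `e ∈ W`.
The basis vector indexed by `T ⊆ W` of the exterior algebra is labelled by the complement
`V = W \ T`, which turns the Koszul complex into a cochain complex with the signs of the
simplicial boundary map. -/
noncomputable def koszulDiff (K : Type*) [Field K] {n : ℕ} (P : Type*) [AddCommGroup P] [Module K P]
    [Module (MvPolynomial (Fin n) K) P] [IsScalarTower K (MvPolynomial (Fin n) K) P]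
    (W : Finset (Fin n)) : (Finset (Fin n) → P) →ₗ[K] (Finset (Fin n) → P) where
  toFun c V := if V ⊆ W then
    ∑ e ∈ V, (-1 : K) ^ (V.filter (· < e)).card • ((X e : MvPolynomial (Fin n) K) • c (V.erase e))
    else 0
  map_add' c c' := by
    ext V
    by_cases hV : V ⊆ W
    · simp [hV, Finset.sum_add_distrib]
    · simp [hV]
  map_smul' t c := by
    ext V
    by_cases hV : V ⊆ W
    · simp only [Pi.smul_apply, if_pos hV, RingHom.id_apply, Finset.smul_sum]
      refine Finset.sum_congr rfl fun e _ => ?_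
      rw [← smul_comm t (X e : MvPolynomial (Fin n) K), ← smul_comm t]
    · simp [hV]

theorem koszulDiff_apply_of_subset {V W : Finset (Fin n)} (hV : V ⊆ W) (c : Finset (Fin n) → P) :
    koszulDiff K P W c V = ∑ e ∈ V, (-1 : K) ^ (V.filter (· < e)).card •
      ((X e : MvPolynomial (Fin n) K) • c (V.erase e)) :=
  if_pos hV

theorem koszulDiff_apply_of_not_subset {V W : Finset (Fin n)} (hV : ¬ V ⊆ W)
    (c : Finset (Fin n) → P) : koszulDiff K P W c V = 0 :=
  if_neg hV

theorem koszulDiff_koszulDiff (W : Finset (Fin n)) (c : Finset (Fin n) → P) :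
    koszulDiff K P W (koszulDiff K P W c) = 0 := by
  ext V
  by_cases hV : V ⊆ W
  swap
  · exact koszulDiff_apply_of_not_subset hV _
  rw [koszulDiff_apply_of_subset hV]
  simp only [koszulDiff_apply_of_subset ((Finset.erase_subset _ V).trans hV), Finset.smul_sum]
  rw [Finset.sum_sigma', Pi.zero_apply]
  refine Finset.sum_involution (fun p _ => ⟨p.2, p.1⟩) ?_ ?_ ?_ fun _ _ => rfl
  · rintro ⟨e, f⟩ hp
    simp only [Finset.mem_sigma, Finset.mem_erase] at hp
    obtain ⟨he, hfe, hf⟩ := hp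
    dsimp only
    rw [smul_comm (X e : MvPolynomial (Fin n) K) _ ((X f : MvPolynomial (Fin n) K) • _),
      smul_comm (X f : MvPolynomial (Fin n) K) _ ((X e : MvPolynomial (Fin n) K) • _),
      smul_comm (X e : MvPolynomial (Fin n) K) (X f : MvPolynomial (Fin n) K),
      Finset.erase_right_comm, smul_smul ((-1 : K) ^ _), smul_smul ((-1 : K) ^ _),
      sign_mul_sign_erase he hf (Ne.symm hfe), neg_smul, neg_add_cancel]
  · rintro ⟨e, f⟩ hp _ heq
    simp only [Finset.mem_sigma, Finset.mem_erase] at hp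
    have : f = e := congrArg Sigma.fst heq
    exact hp.2.1 this
  · rintro ⟨e, f⟩ hp
    simp only [Finset.mem_sigma, Finset.mem_erase] at hp ⊢
    exact ⟨hp.2.2, hp.2.1.symm, hp.1⟩

/-- The cochains of degree `q` in the part of multidegree `W` of the Koszul complex of a
multigraded module, of which `𝒩 V` is the component in the squarefree degree with support `V`. -/
def koszulCochains (𝒩 : Finset (Fin n) → Submodule K P) (W : Finset (Fin n)) (q : ℤ) :
    Submodule K (Finset (Fin n) → P) where
  carrier := {c | ∀ V, c V ∈ 𝒩 V ∧ (c V ≠ 0 → V ⊆ W ∧ (V.card : ℤ) = q)}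
  zero_mem' V := ⟨zero_mem _, fun h => absurd rfl h⟩
  add_mem' {a b} ha hb V := by
    refine ⟨add_mem (ha V).1 (hb V).1, fun h => ?_⟩
    by_cases h0 : a V = 0
    · exact (hb V).2 fun h1 => h (by simp [h0, h1])
    · exact (ha V).2 h0
  smul_mem' t a ha V :=
    ⟨Submodule.smul_mem _ _ (ha V).1, fun h => (ha V).2 fun h0 => h (by simp [h0])⟩

/-- The cohomology in degree `q` of the part of multidegree `W` of the Koszul complex. -/
abbrev KoszulCohomology (𝒩 : Finset (Fin n) → Submodule K P) (W : Finset (Fin n)) (q : ℤ) :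
    Type _ :=
  ↥(koszulCochains 𝒩 W q ⊓ LinearMap.ker (koszulDiff K P W)) ⧸
    ((koszulCochains 𝒩 W (q - 1)).map (koszulDiff K P W)).comap
      (koszulCochains 𝒩 W q ⊓ LinearMap.ker (koszulDiff K P W)).subtype

theorem koszulDiff_mem {𝒩 : Finset (Fin n) → Submodule K P}
    (hX : ∀ V, ∀ e ∈ V, ∀ x ∈ 𝒩 (V.erase e), (X e : MvPolynomial (Fin n) K) • x ∈ 𝒩 V)
    {W : Finset (Fin n)} {q : ℤ} {c : Finset (Fin n) → P} (hc : c ∈ koszulCochains 𝒩 W q) :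
    koszulDiff K P W c ∈ koszulCochains 𝒩 W (q + 1) := by
  intro V
  by_cases hV : V ⊆ W
  swap
  · rw [koszulDiff_apply_of_not_subset hV]
    exact ⟨zero_mem _, fun h => absurd rfl h⟩
  rw [koszulDiff_apply_of_subset hV]
  refine ⟨Submodule.sum_mem _ fun e he => Submodule.smul_mem _ _ (hX V e he _ (hc _).1),
    fun hne => ⟨hV, ?_⟩⟩
  obtain ⟨e, he, hne'⟩ := Finset.exists_ne_zero_of_sum_ne_zero hne
  have hce : c (V.erase e) ≠ 0 := fun h0 => hne' (by simp [h0])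
  have := ((hc _).2 hce).2
  rw [← Finset.card_erase_add_one he]
  push_cast
  omega

omit [Module (MvPolynomial (Fin n) K) P] [IsScalarTower K (MvPolynomial (Fin n) K) P] in
theorem koszulCochains_eq_zero_of_card_lt {𝒩 : Finset (Fin n) → Submodule K P}
    {W : Finset (Fin n)} {q : ℤ} (hq : (W.card : ℤ) < q) {c : Finset (Fin n) → P}
    (hc : c ∈ koszulCochains 𝒩 W q) : c = 0 := by
  ext V
  by_contra hne
  obtain ⟨hV, hcard⟩ := (hc V).2 hne
  have := Finset.card_le_card hV
  omega

variable {Q : Type*} [AddCommGroup Q] [Module K Q] [Module (MvPolynomial (Fin n) K) Q]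
  [IsScalarTower K (MvPolynomial (Fin n) K) Q]

theorem koszulDiff_compLeft (W : Finset (Fin n)) (f : P →ₗ[MvPolynomial (Fin n) K] Q)
    (c : Finset (Fin n) → P) :
    koszulDiff K Q W ((f.restrictScalars K).compLeft _ c) =
      (f.restrictScalars K).compLeft _ (koszulDiff K P W c) := by
  ext V
  by_cases hV : V ⊆ W
  · simp only [koszulDiff_apply_of_subset hV, LinearMap.compLeft_apply, Function.comp_apply,
      map_sum, map_smul, LinearMap.restrictScalars_apply]
  · simp only [koszulDiff_apply_of_not_subset hV, LinearMap.compLeft_apply, Function.comp_apply,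
      map_zero]

theorem compLeft_mem_koszulCochains {𝓑 : Finset (Fin n) → Submodule K P}
    {𝓒 : Finset (Fin n) → Submodule K Q} {f : P →ₗ[MvPolynomial (Fin n) K] Q}
    (hf : ∀ V, ∀ x ∈ 𝓑 V, f x ∈ 𝓒 V) {W : Finset (Fin n)} {q : ℤ} {c : Finset (Fin n) → P}
    (hc : c ∈ koszulCochains 𝓑 W q) :
    (f.restrictScalars K).compLeft _ c ∈ koszulCochains 𝓒 W q :=
  fun V => ⟨hf V _ (hc V).1, fun h => (hc V).2 fun h0 => h (by simp [h0])⟩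

theorem exists_koszulCochains_lift {𝓑 : Finset (Fin n) → Submodule K P}
    {𝓒 : Finset (Fin n) → Submodule K Q} {f : P →ₗ[MvPolynomial (Fin n) K] Q}
    (hf : ∀ V, ∀ y ∈ 𝓒 V, ∃ x ∈ 𝓑 V, f x = y) {W : Finset (Fin n)} {q : ℤ}
    {c : Finset (Fin n) → Q} (hc : c ∈ koszulCochains 𝓒 W q) :
    ∃ b ∈ koszulCochains 𝓑 W q, (f.restrictScalars K).compLeft _ b = c := by
  classical
  choose b hb hfb using fun V => hf V (c V) (hc V).1
  refine ⟨fun V => if c V = 0 then 0 else b V, fun V => ?_, ?_⟩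
  · by_cases h0 : c V = 0
    · simp [h0]
    · simpa [h0, hb V] using fun _ => (hc V).2 h0
  · ext V
    by_cases h0 : c V = 0
    · simp [h0]
    · simp [h0, hfb]

end Module

/-! ### Dimension shifting -/

/-- Two subquotients of vector spaces have the same dimension if they are images of one space under
two linear maps whose kernels agree. -/
theorem finrank_subquotient_eq {E E₁ E₂ : Type*} [AddCommGroup E] [Module K E] [AddCommGroup E₁]
    [Module K E₁] [AddCommGroup E₂] [Module K E₂] (L : Submodule K E) (g₁ : E →ₗ[K] E₁)
    (g₂ : E →ₗ[K] E₂) {Z₁ B₁ : Submodule K E₁} {Z₂ B₂ : Submodule K E₂} (h₁ : L.map g₁ = Z₁)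
    (h₂ : L.map g₂ = Z₂) (h : ∀ x ∈ L, g₁ x ∈ B₁ ↔ g₂ x ∈ B₂) :
    Module.finrank K (Z₁ ⧸ B₁.comap Z₁.subtype) = Module.finrank K (Z₂ ⧸ B₂.comap Z₂.subtype) := by
  have hm₁ : ∀ x ∈ L, g₁ x ∈ Z₁ := fun x hx => h₁ ▸ Submodule.mem_map_of_mem hx
  have hm₂ : ∀ x ∈ L, g₂ x ∈ Z₂ := fun x hx => h₂ ▸ Submodule.mem_map_of_mem hx
  let φ₁ : L →ₗ[K] Z₁ ⧸ B₁.comap Z₁.subtype := Submodule.mkQ _ ∘ₗ g₁.restrict hm₁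
  let φ₂ : L →ₗ[K] Z₂ ⧸ B₂.comap Z₂.subtype := Submodule.mkQ _ ∘ₗ g₂.restrict hm₂
  have hs₁ : Function.Surjective φ₁ := by
    refine (Submodule.mkQ_surjective _).comp ?_
    rintro ⟨z, hz⟩
    obtain ⟨x, hx, rfl⟩ : z ∈ L.map g₁ := h₁ ▸ hz
    exact ⟨⟨x, hx⟩, rfl⟩
  have hs₂ : Function.Surjective φ₂ := by
    refine (Submodule.mkQ_surjective _).comp ?_
    rintro ⟨z, hz⟩
    obtain ⟨x, hx, rfl⟩ : z ∈ L.map g₂ := h₂ ▸ hz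
    exact ⟨⟨x, hx⟩, rfl⟩
  have hk : LinearMap.ker φ₁ = LinearMap.ker φ₂ := by
    ext ⟨x, hx⟩
    simpa [φ₁, φ₂, Submodule.Quotient.mk_eq_zero] using h x hx
  rw [← (φ₁.quotKerEquivOfSurjective hs₁).finrank_eq, hk,
    (φ₂.quotKerEquivOfSurjective hs₂).finrank_eq]

section Shift

variable {P Q : Type*} [AddCommGroup P] [Module K P] [Module (MvPolynomial (Fin n) K) P]
  [IsScalarTower K (MvPolynomial (Fin n) K) P]
  [AddCommGroup Q] [Module K Q] [Module (MvPolynomial (Fin n) K) Q]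
  [IsScalarTower K (MvPolynomial (Fin n) K) Q]

/-- The connecting isomorphism `H^q(𝓒) ≅ H^{q+1}(Ker f)` for a degreewise surjective map
`f : 𝓑 → 𝓒`. Instead of `H^{q+1}(𝓑) = 0` it is enough that the map
`H^{q+1}(Ker f) → H^{q+1}(𝓑)` is zero. -/
theorem finrank_koszulCohomology_ker {𝓑 : Finset (Fin n) → Submodule K P}
    {𝓒 : Finset (Fin n) → Submodule K Q} {f : P →ₗ[MvPolynomial (Fin n) K] Q}
    (hX : ∀ V, ∀ e ∈ V, ∀ x ∈ 𝓑 (V.erase e), (X e : MvPolynomial (Fin n) K) • x ∈ 𝓑 V)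
    (hf : ∀ V, ∀ x ∈ 𝓑 V, f x ∈ 𝓒 V) (hsurj : ∀ V, ∀ y ∈ 𝓒 V, ∃ x ∈ 𝓑 V, f x = y)
    {W : Finset (Fin n)} {q : ℤ}
    (hq : ∀ c ∈ koszulCochains 𝓑 W q, koszulDiff K P W c = 0 →
      ∃ b ∈ koszulCochains 𝓑 W (q - 1), koszulDiff K P W b = c)
    (hq' : ∀ c ∈ koszulCochains 𝓑 W (q + 1), (∀ V, f (c V) = 0) → koszulDiff K P W c = 0 →
      ∃ b ∈ koszulCochains 𝓑 W q, koszulDiff K P W b = c) :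
    Module.finrank K (KoszulCohomology 𝓒 W q) =
      Module.finrank K (KoszulCohomology
        (fun V => 𝓑 V ⊓ (LinearMap.ker f).restrictScalars K) W (q + 1)) := by
  set F : (Finset (Fin n) → P) →ₗ[K] (Finset (Fin n) → Q) := (f.restrictScalars K).compLeft _
    with hF
  have hcomm : ∀ c, koszulDiff K Q W (F c) = F (koszulDiff K P W c) := koszulDiff_compLeft W f
  have hker : ∀ {p : ℤ} {c : Finset (Fin n) → P}, c ∈ koszulCochains 𝓑 W p → F c = 0 →
      c ∈ koszulCochains (fun V => 𝓑 V ⊓ (LinearMap.ker f).restrictScalars K) W p :=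
    fun hc h0 V => ⟨⟨(hc V).1, congrFun h0 V⟩, (hc V).2⟩
  have hsub : ∀ {p : ℤ} {c : Finset (Fin n) → P},
      c ∈ koszulCochains (fun V => 𝓑 V ⊓ (LinearMap.ker f).restrictScalars K) W p →
      c ∈ koszulCochains 𝓑 W p ∧ F c = 0 :=
    fun hc => ⟨fun V => ⟨(hc V).1.1, (hc V).2⟩, funext fun V => (hc V).1.2⟩
  refine finrank_subquotient_eq
    (koszulCochains 𝓑 W q ⊓ LinearMap.ker (koszulDiff K Q W ∘ₗ F)) F (koszulDiff K P W) ?_ ?_ ?_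
  · ext c
    constructor
    · rintro ⟨b, ⟨hb, hb0⟩, rfl⟩
      exact ⟨compLeft_mem_koszulCochains hf hb, hb0⟩
    · rintro ⟨hc, hc0⟩
      obtain ⟨b, hb, rfl⟩ := exists_koszulCochains_lift hsurj hc
      exact ⟨b, ⟨hb, hc0⟩, rfl⟩
  · ext c
    constructor
    · rintro ⟨b, ⟨hb, hb0⟩, rfl⟩
      refine ⟨hker (koszulDiff_mem hX hb) ?_, koszulDiff_koszulDiff W b⟩
      rw [← hcomm]
      exact hb0
    · rintro ⟨hc, hc0⟩
      obtain ⟨hcB, hcF⟩ := hsub hc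
      obtain ⟨b, hb, rfl⟩ := hq' c hcB (fun V => congrFun hcF V) hc0
      exact ⟨b, ⟨hb, (hcomm b).trans hcF⟩, rfl⟩
  · rintro b ⟨hb, hb0⟩
    rw [add_sub_cancel_right]
    constructor
    · rintro ⟨c, hc, hcb⟩
      obtain ⟨b', hb', rfl⟩ := exists_koszulCochains_lift hsurj hc
      have hdb' := koszulDiff_mem hX hb'
      rw [sub_add_cancel] at hdb'
      refine ⟨b - koszulDiff K P W b', hker (Submodule.sub_mem _ hb hdb') ?_, ?_⟩
      · rw [map_sub, ← hcomm, sub_eq_zero]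
        exact hcb.symm
      · rw [map_sub, koszulDiff_koszulDiff, sub_zero]
    · rintro ⟨a, ha, hab⟩
      obtain ⟨haB, haF⟩ := hsub ha
      obtain ⟨b', hb', hdb'⟩ := hq (b - a) (Submodule.sub_mem _ hb haB)
        (by rw [map_sub, hab, sub_self])
      refine ⟨F b', compLeft_mem_koszulCochains hf hb', ?_⟩
      rw [hcomm, hdb', map_sub, haF, sub_zero]

end Shift

/-! ### The Koszul complex of a graded free module -/

section FreeModule

/-- The cone construction: scalar cochains supported on the intervals `[U, W]`, with `e ∈ W \ U`,
form an acyclic complex, with contracting homotopy given by removing `e`. -/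
theorem sum_sign_mul_cone {W : Finset (Fin n)} {e : Fin n} (he : e ∈ W) {a : Finset (Fin n) → K}
    (ha : ∀ V ⊆ W, ∑ f ∈ V, (-1) ^ (V.filter (· < f)).card * a (V.erase f) = 0)
    {V : Finset (Fin n)} (hV : V ⊆ W) :
    ∑ f ∈ V, (-1) ^ (V.filter (· < f)).card *
      (if e ∈ V.erase f then 0 else
        (-1) ^ ((insert e (V.erase f)).filter (· < e)).card * a (insert e (V.erase f))) = a V := by
  have hsq : ∀ k : ℕ, (-1 : K) ^ k * (-1) ^ k = 1 := fun k => by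
    rw [← mul_pow, neg_mul_neg, one_mul, one_pow]
  by_cases heV : e ∈ V
  · rw [Finset.sum_eq_single e]
    · rw [if_neg (Finset.notMem_erase e V), Finset.insert_erase heV, ← mul_assoc, hsq, one_mul]
    · intro f _ hfe
      rw [if_pos (Finset.mem_erase.2 ⟨hfe.symm, heV⟩), mul_zero]
    · intro h
      exact absurd heV h
  · have hU := ha (insert e V) (Finset.insert_subset he hV)
    rw [Finset.sum_insert heV, Finset.erase_insert heV] at hU
    have hterm : ∀ f ∈ V, (-1 : K) ^ (V.filter (· < f)).card *
        (if e ∈ V.erase f then 0 else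
          (-1) ^ ((insert e (V.erase f)).filter (· < e)).card * a (insert e (V.erase f))) =
        -((-1) ^ ((insert e V).filter (· < e)).card *
          ((-1) ^ ((insert e V).filter (· < f)).card * a ((insert e V).erase f))) := by
      intro f hf
      have hfe : e ≠ f := fun h => heV (h ▸ hf)
      have hsign := sign_mul_sign_erase (K := K) (Finset.mem_insert_self e V)
        (Finset.mem_insert_of_mem hf) hfe
      rw [Finset.erase_insert heV] at hsign
      rw [if_neg fun h => heV (Finset.mem_of_mem_erase h), Finset.erase_insert_of_ne hfe] at *
      linear_combination
        (-1 : K) ^ ((insert e V).filter (· < e)).card *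
          (-1) ^ ((insert e (V.erase f)).filter (· < e)).card *
          a (insert e (V.erase f)) * hsign -
        (-1) ^ (V.filter (· < f)).card *
          (-1) ^ ((insert e (V.erase f)).filter (· < e)).card * a (insert e (V.erase f)) *
          hsq ((insert e V).filter (· < e)).card -
        (-1) ^ ((insert e V).filter (· < e)).card * (-1) ^ ((insert e V).filter (· < f)).card *
          a (insert e (V.erase f)) * hsq ((insert e (V.erase f)).filter (· < e)).card
    rw [Finset.sum_congr rfl hterm, Finset.sum_neg_distrib, ← Finset.mul_sum]
    linear_combination -(-1 : K) ^ ((insert e V).filter (· < e)).card * hU +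
      a V * hsq ((insert e V).filter (· < e)).card

variable {r : ℕ}

/-- The components of a graded free module in squarefree degrees. -/
noncomputable abbrev freeSquarefree (K : Type*) [Field K] {n r : ℕ} (deg : Fin r → Fin n →₀ ℕ)
    (V : Finset (Fin n)) : Submodule K (Fin r → MvPolynomial (Fin n) K) :=
  gradedFreeComponent (fineGrading K n) deg (squarefreeVector V)

theorem X_smul_mem_freeSquarefree (deg : Fin r → Fin n →₀ ℕ) (V : Finset (Fin n)) (e : Fin n)
    (he : e ∈ V) (x : Fin r → MvPolynomial (Fin n) K)
    (hx : x ∈ freeSquarefree K deg (V.erase e)) :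
    (X e : MvPolynomial (Fin n) K) • x ∈ freeSquarefree K deg V := by
  have := monomial_smul_mem_free deg (Finsupp.single e 1) (1 : K) _ x hx
  rwa [single_add_squarefreeVector_erase he] at this

theorem koszulDiff_apply_eq_monomial {W : Finset (Fin n)} {j : Fin r} {d : Fin n →₀ ℕ}
    {c : Finset (Fin n) → Fin r → MvPolynomial (Fin n) K} {a : Finset (Fin n) → K}
    (hc : ∀ V, c V j = monomial (squarefreeVector V - d) (a V))
    (ha : ∀ V, a V ≠ 0 → d ≤ squarefreeVector V) {V : Finset (Fin n)} (hV : V ⊆ W) :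
    koszulDiff K _ W c V j = monomial (squarefreeVector V - d)
      (∑ f ∈ V, (-1) ^ (V.filter (· < f)).card * a (V.erase f)) := by
  rw [koszulDiff_apply_of_subset hV, Finset.sum_apply, map_sum]
  refine Finset.sum_congr rfl fun f hf => ?_
  rw [Pi.smul_apply, Pi.smul_apply, hc, smul_eq_mul, ← smul_eq_mul (_ ^ _), ← smul_monomial]
  congr 1
  by_cases h0 : a (V.erase f) = 0
  · simp [h0]
  · rw [X, monomial_mul, one_mul, ← single_add_squarefreeVector_erase hf,
      add_tsub_assoc_of_le (ha _ h0)]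

/-- The Koszul complex of a graded free module is exact, apart from the summands whose generator
lives in the multidegree `W` itself. -/
theorem exists_koszulDiff_eq_of_free {deg : Fin r → Fin n →₀ ℕ} {W : Finset (Fin n)} {q : ℤ}
    {c : Finset (Fin n) → Fin r → MvPolynomial (Fin n) K}
    (hc : c ∈ koszulCochains (freeSquarefree K deg) W q) (hdc : koszulDiff K _ W c = 0)
    (htop : ∀ j, deg j = squarefreeVector W → c W j = 0) :
    ∃ b ∈ koszulCochains (freeSquarefree K deg) W (q - 1), koszulDiff K _ W b = c := by
  classical
  let a : Fin r → Finset (Fin n) → K := fun j V => coeff (squarefreeVector V - deg j) (c V j)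
  have hdeg : ∀ j V b, coeff b (c V j) ≠ 0 → b + deg j = squarefreeVector V := fun j V =>
    mem_gradedFreeComponent.1 (hc V).1 j
  have hle : ∀ j V, a j V ≠ 0 → deg j ≤ squarefreeVector V := fun j V h =>
    hdeg j V _ h ▸ le_add_self
  have hca : ∀ j V, c V j = monomial (squarefreeVector V - deg j) (a j V) := by
    intro j V
    ext b
    rw [coeff_monomial]
    split_ifs with hb
    · rw [← hb]
    · by_contra hne
      exact hb (by rw [← hdeg j V b hne, add_tsub_cancel_right])
  have hsupp : ∀ j V, a j V ≠ 0 → V ⊆ W ∧ (V.card : ℤ) = q := fun j V h =>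
    (hc V).2 fun h0 => h (by simp [a, h0])
  have hcyc : ∀ j, ∀ V ⊆ W,
      ∑ f ∈ V, (-1) ^ (V.filter (· < f)).card * a j (V.erase f) = 0 := by
    intro j V hV
    have := koszulDiff_apply_eq_monomial (hca j) (hle j) hV
    rw [hdc] at this
    exact monomial_eq_zero.1 this.symm
  have hex : ∀ j, ∃ b : Finset (Fin n) → K,
      (∀ V, b V ≠ 0 → V ⊆ W ∧ (V.card : ℤ) = q - 1 ∧ deg j ≤ squarefreeVector V) ∧
      ∀ V ⊆ W, ∑ f ∈ V, (-1) ^ (V.filter (· < f)).card * b (V.erase f) = a j V := by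
    intro j
    by_cases hall : ∀ V, a j V = 0
    · exact ⟨0, fun V h => absurd rfl h, fun V _ => by simp [hall V]⟩
    push Not at hall
    obtain ⟨V₀, hV₀⟩ := hall
    have hVW := (hsupp j V₀ hV₀).1
    have hdW : deg j ≤ squarefreeVector W :=
      (hle j V₀ hV₀).trans (squarefreeVector_le_iff.2 hVW)
    have hne : deg j ≠ squarefreeVector W := by
      intro h
      have hV₀W : V₀ = W := hVW.antisymm (squarefreeVector_le_iff.1 (h ▸ hle j V₀ hV₀))
      refine hV₀ ?_
      have hz := htop j h
      rw [← hV₀W] at hz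
      simp [a, hz]
    obtain ⟨e, he⟩ : ∃ e, deg j e ≠ squarefreeVector W e := by
      by_contra! h
      exact hne (Finsupp.ext h)
    have hlt := lt_of_le_of_ne (hdW e) he
    rw [squarefreeVector_apply] at hlt
    have heW : e ∈ W := by
      by_contra h
      rw [if_neg h] at hlt
      omega
    rw [if_pos heW] at hlt
    refine ⟨fun V => if e ∈ V then 0 else
      (-1) ^ ((insert e V).filter (· < e)).card * a j (insert e V), fun V hV => ?_,
      fun V hV => sum_sign_mul_cone heW (hcyc j) hV⟩
    have heV : e ∉ V := fun h => hV (if_pos h)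
    simp only [if_neg heV] at hV
    have ha := right_ne_zero_of_mul hV
    obtain ⟨hiW, hcard⟩ := hsupp j _ ha
    rw [Finset.card_insert_of_notMem heV] at hcard
    refine ⟨(Finset.subset_insert e V).trans hiW, by push_cast at hcard; omega, fun i => ?_⟩
    by_cases hi : i = e
    · subst hi
      omega
    · have := hle j _ ha i
      simpa [squarefreeVector_apply, hi] using this
  choose b hb hab using hex
  have hbc : ∀ j V, (fun V j => monomial (squarefreeVector V - deg j) (b j V) :
      Finset (Fin n) → Fin r → MvPolynomial (Fin n) K) V j =
      monomial (squarefreeVector V - deg j) (b j V) := fun _ _ => rfl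
  refine ⟨fun V j => monomial (squarefreeVector V - deg j) (b j V), fun V => ⟨?_, fun hne => ?_⟩,
    ?_⟩
  · rw [mem_gradedFreeComponent]
    intro j x hx
    rw [coeff_monomial] at hx
    split_ifs at hx with hx'
    · rw [← hx', tsub_add_cancel_of_le (hb j V hx).2.2]
    · exact absurd rfl hx
  · obtain ⟨j, hj⟩ := Function.ne_iff.1 hne
    have hbj : b j V ≠ 0 := fun h0 => hj (by simp [h0])
    exact ⟨(hb j V hbj).1, (hb j V hbj).2.1⟩
  · ext1 V
    by_cases hV : V ⊆ W
    · ext1 j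
      rw [koszulDiff_apply_eq_monomial (hbc j) (fun V h => (hb j V h).2.2) hV, hab j V hV, hca]
    · rw [koszulDiff_apply_of_not_subset hV]
      by_contra hne
      exact hV ((hc V).2 fun h => hne h.symm).1

end FreeModule

end Koszul

/-! ### Covers by graded free modules -/

section Cover

variable {K : Type*} [Field K] {n r : ℕ}

open MvPolynomial

variable {Q : Type*} [AddCommGroup Q] [Module K Q] [Module (MvPolynomial (Fin n) K) Q]
  [IsScalarTower K (MvPolynomial (Fin n) K) Q] {𝒬 : Finset (Fin n) → Submodule K Q}
  {deg : Fin r → Fin n →₀ ℕ}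
  {f : (Fin r → MvPolynomial (Fin n) K) →ₗ[MvPolynomial (Fin n) K] Q}
  {W : Finset (Fin n)}

theorem eq_zero_of_mem_freeSquarefree {x : Fin r → MvPolynomial (Fin n) K}
    (hx : x ∈ freeSquarefree K deg W) {j : Fin r} (hj : deg j = squarefreeVector W)
    (h0 : coeff 0 (x j) = 0) : x j = 0 := by
  ext a
  by_contra hne
  have := mem_gradedFreeComponent.1 hx j a hne
  rw [hj, add_eq_right] at this
  exact hne (this ▸ h0)

/-- Dimension shifting along a minimal cover by a graded free module. -/
theorem finrank_koszulCohomology_of_cover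
    (hf : ∀ V, ∀ x ∈ freeSquarefree K deg V, f x ∈ 𝒬 V)
    (hsurj : ∀ V, ∀ y ∈ 𝒬 V, ∃ x ∈ freeSquarefree K deg V, f x = y)
    (hmin : LinearMap.ker f ≤ gradedMaximalIdeal (fineGrading K n) • ⊤)
    {q : ℤ} (hq : q < W.card) :
    Module.finrank K (KoszulCohomology 𝒬 W q) =
      Module.finrank K (KoszulCohomology
        (fun V => freeSquarefree K deg V ⊓ (LinearMap.ker f).restrictScalars K) W (q + 1)) := by
  refine finrank_koszulCohomology_ker (X_smul_mem_freeSquarefree deg) hf hsurj ?_ ?_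
  · intro c hc hdc
    refine exists_koszulDiff_eq_of_free hc hdc fun j _ => ?_
    have hW : c W = 0 := by
      by_contra hne
      exact hq.ne' ((hc W).2 hne).2
    rw [hW, Pi.zero_apply]
  · intro c hc hfc hdc
    obtain ⟨b, hb, hbc⟩ := exists_koszulDiff_eq_of_free hc hdc fun j hj =>
      eq_zero_of_mem_freeSquarefree (hc W).1 hj
        (mem_gradedMaximalIdeal_smul_top.1 (hmin (hfc W)) j)
    rw [add_sub_cancel_right] at hb
    exact ⟨b, hb, hbc⟩

/-- In top degree the Koszul cohomology counts the generators of degree `W` of a minimal cover. -/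
theorem finrank_koszulCohomology_card_of_cover
    (hf : ∀ V, ∀ x ∈ freeSquarefree K deg V, f x ∈ 𝒬 V)
    (hsurj : ∀ V, ∀ y ∈ 𝒬 V, ∃ x ∈ freeSquarefree K deg V, f x = y)
    (hmin : LinearMap.ker f ≤ gradedMaximalIdeal (fineGrading K n) • ⊤)
    (hX : ∀ V, ∀ e ∈ V, ∀ x ∈ 𝒬 (V.erase e), (X e : MvPolynomial (Fin n) K) • x ∈ 𝒬 V) :
    Module.finrank K (KoszulCohomology 𝒬 W W.card) =
      Nat.card {j // deg j = squarefreeVector W} := by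
  classical
  let F : (Finset (Fin n) → Fin r → MvPolynomial (Fin n) K) →ₗ[K] (Finset (Fin n) → Q) :=
    (f.restrictScalars K).compLeft _
  have hcomm : ∀ c, koszulDiff K Q W (F c) = F (koszulDiff K _ W c) := koszulDiff_compLeft W f
  let ε : (Finset (Fin n) → Fin r → MvPolynomial (Fin n) K) →ₗ[K]
      ({j // deg j = squarefreeVector W} → K) :=
    LinearMap.pi fun j => lcoeff K 0 ∘ₗ LinearMap.proj (j : Fin r) ∘ₗ LinearMap.proj W
  have hε : ∀ c j, ε c j = coeff 0 (c W j) := fun _ _ => rfl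
  have hεd : ∀ c, ε (koszulDiff K _ W c) = 0 := by
    intro c
    ext j
    rw [hε, koszulDiff_apply_of_subset subset_rfl, Finset.sum_apply, coeff_sum]
    refine Finset.sum_eq_zero fun e _ => ?_
    simp [coeff_X_mul']
  have hmap : (koszulCochains (freeSquarefree K deg) W W.card).map ε = ⊤ := by
    rw [eq_top_iff]
    intro α _
    refine ⟨Pi.single W fun j =>
      if h : deg j = squarefreeVector W then C (α ⟨j, h⟩) else 0, fun V => ?_, ?_⟩
    · by_cases hV : V = W
      · subst hV
        refine ⟨?_, fun _ => ⟨subset_rfl, rfl⟩⟩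
        rw [Pi.single_eq_same, mem_gradedFreeComponent]
        intro j a ha
        split_ifs at ha with h
        · rw [coeff_C] at ha
          split_ifs at ha with h0
          · rw [← h0, zero_add, h]
          · exact absurd rfl ha
        · exact absurd (coeff_zero a) ha
      · rw [Pi.single_eq_of_ne hV]
        exact ⟨zero_mem _, fun h => absurd rfl h⟩
    · ext ⟨j, hj⟩
      rw [hε, Pi.single_eq_same, dif_pos hj, coeff_C, if_pos rfl]
  have hZ : (koszulCochains (freeSquarefree K deg) W W.card).map F =
      koszulCochains 𝒬 W W.card ⊓ LinearMap.ker (koszulDiff K Q W) := by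
    ext c
    constructor
    · rintro ⟨b, hb, rfl⟩
      have hFb := compLeft_mem_koszulCochains hf hb
      exact ⟨hFb, koszulCochains_eq_zero_of_card_lt (lt_add_one _) (koszulDiff_mem hX hFb)⟩
    · rintro ⟨hc, -⟩
      obtain ⟨b, hb, rfl⟩ := exists_koszulCochains_lift hsurj hc
      exact ⟨b, hb, rfl⟩
  have key := finrank_subquotient_eq (koszulCochains (freeSquarefree K deg) W W.card) F ε
    (B₁ := (koszulCochains 𝒬 W (W.card - 1)).map (koszulDiff K Q W)) (B₂ := ⊥) hZ hmap ?_
  · rw [key, Submodule.comap_bot, Submodule.ker_subtype,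
      (Submodule.quotEquivOfEqBot _ rfl).finrank_eq, finrank_top, Module.finrank_fintype_fun_eq_card,
      Nat.card_eq_fintype_card]
  intro x hx
  rw [Submodule.mem_bot]
  constructor
  · rintro ⟨c, hc, hcx⟩
    obtain ⟨b, hb, rfl⟩ := exists_koszulCochains_lift hsurj hc
    have h0 : F (x - koszulDiff K _ W b) = 0 := by
      rw [map_sub, ← hcomm, sub_eq_zero]
      exact hcx.symm
    have h1 : ε (x - koszulDiff K _ W b) = 0 := by
      ext j
      exact mem_gradedMaximalIdeal_smul_top.1
        (hmin (show x W - koszulDiff K _ W b W ∈ LinearMap.ker f from congrFun h0 W)) j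
    rwa [map_sub, hεd, sub_zero] at h1
  · intro h0
    obtain ⟨b, hb, rfl⟩ := exists_koszulDiff_eq_of_free hx
      (koszulCochains_eq_zero_of_card_lt (lt_add_one _)
        (koszulDiff_mem (X_smul_mem_freeSquarefree deg) hx))
      fun j hj => eq_zero_of_mem_freeSquarefree (hx W).1 hj (congrFun h0 ⟨j, hj⟩)
    exact ⟨F b, compLeft_mem_koszulCochains hf hb, hcomm b⟩

end Cover

/-! ### Betti numbers as Koszul cohomology -/

section Betti

variable {K : Type*} [Field K] {n : ℕ}

open MvPolynomial

namespace GradedFreeResolution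

variable {Δ : VertexComplex n} (F : GradedFreeResolution (fineGrading K n) (Δ.ringGrading K))
  (W : Finset (Fin n))

/-- The components, in squarefree degrees, of the kernel of `d i : F_{i+1} → F_i`. -/
noncomputable def kerSquarefree (i : ℕ) (V : Finset (Fin n)) :
    Submodule K (Fin (F.rank (i + 1)) → MvPolynomial (Fin n) K) :=
  freeSquarefree K (F.deg (i + 1)) V ⊓ (LinearMap.ker (F.d i)).restrictScalars K

/-- The components, in squarefree degrees, of the kernel of the augmentation `F_0 → K[Δ]`. -/
noncomputable def kerAugSquarefree (V : Finset (Fin n)) :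
    Submodule K (Fin (F.rank 0) → MvPolynomial (Fin n) K) :=
  freeSquarefree K (F.deg 0) V ⊓ (LinearMap.ker F.aug).restrictScalars K

theorem exists_mem_of_mem_kerSquarefree (i : ℕ) (V : Finset (Fin n))
    (y : Fin (F.rank (i + 1)) → MvPolynomial (Fin n) K) (hy : y ∈ F.kerSquarefree i V) :
    ∃ x ∈ freeSquarefree K (F.deg (i + 2)) V, F.d (i + 1) x = y :=
  (isGradedBy_free (F.deg (i + 2))).exists_mem_of_mem_range (isGradedBy_free (F.deg (i + 1)))
    ((F.d (i + 1)).restrictScalars K) (F.d_homogeneous (i + 1)) hy.1 ((F.exact_succ i y).1 hy.2)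

theorem exists_mem_of_mem_kerAugSquarefree (V : Finset (Fin n))
    (y : Fin (F.rank 0) → MvPolynomial (Fin n) K) (hy : y ∈ F.kerAugSquarefree V) :
    ∃ x ∈ freeSquarefree K (F.deg 1) V, F.d 0 x = y :=
  (isGradedBy_free (F.deg 1)).exists_mem_of_mem_range (isGradedBy_free (F.deg 0))
    ((F.d 0).restrictScalars K) (F.d_homogeneous 0) hy.1 ((F.exact_zero y).1 hy.2)

theorem exists_mem_of_mem_ringGrading (V : Finset (Fin n)) (y : Δ.StanleyReisnerRing K)
    (hy : y ∈ Δ.ringGrading K (squarefreeVector V)) :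
    ∃ x ∈ freeSquarefree K (F.deg 0) V, F.aug x = y :=
  (isGradedBy_free (F.deg 0)).exists_mem_of_mem_range Δ.isGradedBy_ring
    (F.aug.restrictScalars K) F.aug_homogeneous hy (F.aug_surjective y)

theorem map_mem_kerSquarefree (i : ℕ) (V : Finset (Fin n))
    (x : Fin (F.rank (i + 2)) → MvPolynomial (Fin n) K)
    (hx : x ∈ freeSquarefree K (F.deg (i + 2)) V) : F.d (i + 1) x ∈ F.kerSquarefree i V :=
  ⟨F.d_homogeneous (i + 1) _ x hx, (F.exact_succ i _).2 ⟨x, rfl⟩⟩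

theorem map_mem_kerAugSquarefree (V : Finset (Fin n))
    (x : Fin (F.rank 1) → MvPolynomial (Fin n) K)
    (hx : x ∈ freeSquarefree K (F.deg 1) V) : F.d 0 x ∈ F.kerAugSquarefree V :=
  ⟨F.d_homogeneous 0 _ x hx, (F.exact_zero _).2 ⟨x, rfl⟩⟩

variable {F}

theorem IsMinimal.finrank_kerSquarefree (hF : F.IsMinimal) (m i : ℕ) :
    Module.finrank K (KoszulCohomology (F.kerSquarefree i) W (W.card - m)) =
      F.betti (i + 2 + m) (squarefreeVector W) := by
  induction m generalizing i with
  | zero =>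
    rw [Nat.cast_zero, sub_zero]
    refine finrank_koszulCohomology_card_of_cover (F.map_mem_kerSquarefree i)
      (F.exists_mem_of_mem_kerSquarefree i) (hF.2 (i + 1)) fun V e he x hx => ⟨?_, ?_⟩
    · exact X_smul_mem_freeSquarefree _ V e he x hx.1
    · exact Submodule.smul_mem (LinearMap.ker (F.d i)) _ hx.2
  | succ m ih =>
    rw [finrank_koszulCohomology_of_cover (F.map_mem_kerSquarefree i)
      (F.exists_mem_of_mem_kerSquarefree i) (hF.2 (i + 1)) (by push_cast; omega)]
    have := ih (i + 1)
    rw [show i + 2 + (m + 1) = i + 1 + 2 + m by ring, ← this]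
    have hcast : (W.card : ℤ) - ((m + 1 : ℕ) : ℤ) + 1 = W.card - m := by push_cast; ring
    rw [hcast]
    rfl

theorem IsMinimal.finrank_kerAugSquarefree (hF : F.IsMinimal) (m : ℕ) :
    Module.finrank K (KoszulCohomology F.kerAugSquarefree W (W.card - m)) =
      F.betti (1 + m) (squarefreeVector W) := by
  cases m with
  | zero =>
    rw [Nat.cast_zero, sub_zero]
    refine finrank_koszulCohomology_card_of_cover F.map_mem_kerAugSquarefree
      F.exists_mem_of_mem_kerAugSquarefree (hF.2 0) fun V e he x hx => ⟨?_, ?_⟩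
    · exact X_smul_mem_freeSquarefree _ V e he x hx.1
    · exact Submodule.smul_mem (LinearMap.ker F.aug) _ hx.2
  | succ m =>
    rw [finrank_koszulCohomology_of_cover F.map_mem_kerAugSquarefree
      F.exists_mem_of_mem_kerAugSquarefree (hF.2 0) (by push_cast; omega)]
    have := hF.finrank_kerSquarefree W m 0
    rw [show 1 + (m + 1) = 0 + 2 + m by ring, ← this]
    have hcast : (W.card : ℤ) - ((m + 1 : ℕ) : ℤ) + 1 = W.card - m := by push_cast; ring
    rw [hcast]
    rfl

/-- The squarefree Betti numbers are computed by the Koszul complex of `K[Δ]`. -/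
theorem IsMinimal.finrank_koszulCohomology (hF : F.IsMinimal) (m : ℕ) :
    Module.finrank K
      (KoszulCohomology (fun V => Δ.ringGrading K (squarefreeVector V)) W (W.card - m)) =
      F.betti m (squarefreeVector W) := by
  cases m with
  | zero =>
    rw [Nat.cast_zero, sub_zero]
    refine finrank_koszulCohomology_card_of_cover (fun V => F.aug_homogeneous _)
      F.exists_mem_of_mem_ringGrading hF.1 fun V e he x hx => ?_
    have := Δ.monomial_smul_mem_ringGrading (Finsupp.single e 1) (1 : K) _ x hx
    rwa [single_add_squarefreeVector_erase he] at this
  | succ m =>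
    rw [finrank_koszulCohomology_of_cover (fun V => F.aug_homogeneous _)
      F.exists_mem_of_mem_ringGrading hF.1 (by push_cast; omega)]
    have := hF.finrank_kerAugSquarefree W m
    rw [show m + 1 = 1 + m by ring, ← this]
    have hcast : (W.card : ℤ) - ((1 + m : ℕ) : ℤ) + 1 = W.card - m := by push_cast; ring
    rw [hcast]
    rfl

end GradedFreeResolution

end Betti

/-! ### Koszul cohomology of the Stanley–Reisner ring and reduced homology -/

section Duality

variable {K : Type*} [Field K] {n : ℕ}

open MvPolynomial

/-- The dimension of the homology at the source of `T` is determined by the dimension of the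
source and the ranks of the two adjacent maps. -/
theorem finrank_quotient_add_add {E E' : Type*} [AddCommGroup E] [Module K E] [AddCommGroup E']
    [Module K E'] (T : E →ₗ[K] E') {C B : Submodule K E} [FiniteDimensional K C]
    (hB : B ≤ C ⊓ LinearMap.ker T) :
    Module.finrank K (↥(C ⊓ LinearMap.ker T) ⧸ B.comap (C ⊓ LinearMap.ker T).subtype) +
      Module.finrank K B + Module.finrank K (C.map T) = Module.finrank K C := by
  have : FiniteDimensional K ↥(C ⊓ LinearMap.ker T) :=
    Submodule.finiteDimensional_of_le inf_le_left
  have h1 := Submodule.finrank_quotient_add_finrank (B.comap (C ⊓ LinearMap.ker T).subtype)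
  rw [(Submodule.comapSubtypeEquivOfLe hB).finrank_eq] at h1
  have h2 := LinearMap.finrank_range_add_finrank_ker (T.domRestrict C)
  rw [LinearMap.range_domRestrict, LinearMap.ker_domRestrict] at h2
  have h3 : Module.finrank K ((LinearMap.ker T).comap C.subtype) =
      Module.finrank K ↥(C ⊓ LinearMap.ker T) := by
    rw [(C.equivSubtypeMap _).finrank_eq, Submodule.map_comap_subtype]
  omega

namespace VertexComplex

theorem boundary_apply (c : Finset (Fin n) → K) (G : Finset (Fin n)) :
    boundary K n c G =
      ∑ F, (∑ e ∈ F, if F.erase e = G then (-1) ^ (F.filter (· < e)).card else 0) * c F := by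
  classical
  rw [boundary, Fintype.linearCombination_apply, Finset.sum_apply]
  refine Finset.sum_congr rfl fun F _ => ?_
  rw [Pi.smul_apply, Finset.sum_apply, smul_eq_mul, mul_comm]
  congr 1
  refine Finset.sum_congr rfl fun e _ => ?_
  rw [Pi.single_apply]
  exact if_congr eq_comm rfl rfl

theorem boundary_single (F : Finset (Fin n)) (t : K) :
    boundary K n (Pi.single F t) =
      t • ∑ e ∈ F, Pi.single (F.erase e) ((-1 : K) ^ (F.filter (· < e)).card) := by
  classical
  rw [boundary, Fintype.linearCombination_apply_single]

theorem boundary_boundary (c : Finset (Fin n) → K) : boundary K n (boundary K n c) = 0 := by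
  classical
  rw [← Finset.univ_sum_single c, map_sum, map_sum]
  refine Finset.sum_eq_zero fun F _ => ?_
  rw [boundary_single, map_smul, map_sum]
  simp only [boundary_single, Finset.smul_sum]
  rw [Finset.sum_sigma']
  refine Finset.sum_involution (fun p _ => ⟨p.2, p.1⟩) ?_ ?_ ?_ fun _ _ => rfl
  · rintro ⟨e, f⟩ hp
    simp only [Finset.mem_sigma, Finset.mem_erase] at hp
    obtain ⟨he, hfe, hf⟩ := hp
    dsimp only
    simp only [← Pi.single_smul, smul_eq_mul]
    rw [sign_mul_sign_erase he hf (Ne.symm hfe), Finset.erase_right_comm, ← Pi.single_add, mul_neg,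
      neg_add_cancel, Pi.single_zero]
  · rintro ⟨e, f⟩ hp _ heq
    simp only [Finset.mem_sigma, Finset.mem_erase] at hp
    have : f = e := congrArg Sigma.fst heq
    exact hp.2.1 this
  · rintro ⟨e, f⟩ hp
    simp only [Finset.mem_sigma, Finset.mem_erase] at hp ⊢
    exact ⟨hp.2.2, hp.2.1.symm, hp.1⟩

theorem boundary_mem_chains {Γ : VertexComplex n} {j : ℤ} {c : Finset (Fin n) → K}
    (hc : c ∈ Γ.chains K (j + 1)) : boundary K n c ∈ Γ.chains K j := by
  intro G hG
  rw [boundary_apply] at hG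
  obtain ⟨F, _, hF⟩ := Finset.exists_ne_zero_of_sum_ne_zero hG
  obtain ⟨e, he, hne⟩ := Finset.exists_ne_zero_of_sum_ne_zero (left_ne_zero_of_mul hF)
  have hFG : F.erase e = G := by
    by_contra h
    exact hne (if_neg h)
  obtain ⟨hFΓ, hcard⟩ := hc F (right_ne_zero_of_mul hF)
  rw [← Finset.card_erase_add_one he, hFG] at hcard
  refine ⟨hFG ▸ Γ.down_closed F hFΓ _ (Finset.erase_subset _ _), ?_⟩
  push_cast at hcard
  omega

open Classical in
/-- The matrix of the boundary map from the chains of dimension `j`; the columns of all other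
subsets vanish. -/
noncomputable def boundaryMatrix (K : Type*) [Field K] (Γ : VertexComplex n) (j : ℤ) :
    Matrix (Finset (Fin n)) (Finset (Fin n)) K :=
  fun G F => if F ∈ Γ.faces ∧ (F.card : ℤ) = j + 1 then
    ∑ e ∈ F, if F.erase e = G then (-1) ^ (F.filter (· < e)).card else 0 else 0

theorem map_boundary_chains (Γ : VertexComplex n) (j : ℤ) :
    (Γ.chains K j).map (boundary K n) = LinearMap.range (Γ.boundaryMatrix K j).mulVecLin := by
  classical
  have key : ∀ v : Finset (Fin n) → K, (Γ.boundaryMatrix K j).mulVecLin v =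
      boundary K n fun F => if F ∈ Γ.faces ∧ (F.card : ℤ) = j + 1 then v F else 0 := by
    intro v
    ext G
    rw [boundary_apply, Matrix.mulVecLin_apply, Matrix.mulVec, dotProduct]
    refine Finset.sum_congr rfl fun F _ => ?_
    rw [boundaryMatrix]
    split_ifs <;> simp
  ext x
  constructor
  · rintro ⟨c, hc, rfl⟩
    refine ⟨c, ?_⟩
    rw [key]
    congr 1
    ext F
    split_ifs with h
    · rfl
    · by_contra hne
      exact h (hc F fun h0 => hne h0.symm)
  · rintro ⟨v, rfl⟩
    rw [key]
    refine ⟨_, fun F hF => ?_, rfl⟩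
    by_contra h
    exact hF (if_neg h)

open Classical in
theorem transpose_boundaryMatrix_mulVec (Γ : VertexComplex n) (j : ℤ) (v : Finset (Fin n) → K)
    (F : Finset (Fin n)) :
    (Γ.boundaryMatrix K j).transpose.mulVecLin v F =
      if F ∈ Γ.faces ∧ (F.card : ℤ) = j + 1 then
        ∑ e ∈ F, (-1) ^ (F.filter (· < e)).card * v (F.erase e) else 0 := by
  rw [Matrix.mulVecLin_apply, Matrix.mulVec, dotProduct]
  simp only [Matrix.transpose_apply, boundaryMatrix]
  split_ifs with h
  · simp only [Finset.sum_mul]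
    rw [Finset.sum_comm]
    refine Finset.sum_congr rfl fun e _ => ?_
    simp
  · simp

theorem map_transpose_boundaryMatrix (Γ : VertexComplex n) (j : ℤ) :
    (Γ.chains K (j - 1)).map (Γ.boundaryMatrix K j).transpose.mulVecLin =
      LinearMap.range (Γ.boundaryMatrix K j).transpose.mulVecLin := by
  classical
  refine le_antisymm LinearMap.map_le_range ?_
  rintro _ ⟨v, rfl⟩
  refine ⟨fun G => if G ∈ Γ.faces ∧ (G.card : ℤ) = j - 1 + 1 then v G else 0, fun G hG => ?_, ?_⟩
  · by_contra h
    exact hG (if_neg h)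
  · ext F
    rw [transpose_boundaryMatrix_mulVec, transpose_boundaryMatrix_mulVec]
    refine if_ctx_congr Iff.rfl (fun hF => Finset.sum_congr rfl fun e he => ?_) fun _ => rfl
    rw [if_pos]
    refine ⟨Γ.down_closed F hF.1 _ (Finset.erase_subset _ _), ?_⟩
    have := hF.2
    rw [← Finset.card_erase_add_one he] at this
    push_cast at this
    omega

theorem range_transpose_boundaryMatrix_le (Γ : VertexComplex n) (j : ℤ) :
    LinearMap.range (Γ.boundaryMatrix K j).transpose.mulVecLin ≤ Γ.chains K j := by
  classical
  rintro _ ⟨v, rfl⟩ F hF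
  rw [transpose_boundaryMatrix_mulVec] at hF
  by_contra h
  exact hF (if_neg h)

/-- The linear map sending the indicator function of `V` to the residue class of the squarefree
monomial with support `V`, placed at `V`. -/
noncomputable def faceMonomials (K : Type*) [Field K] (Δ : VertexComplex n) :
    (Finset (Fin n) → K) →ₗ[K] (Finset (Fin n) → Δ.StanleyReisnerRing K) where
  toFun φ V := Ideal.Quotient.mk _ (monomial (squarefreeVector V) (φ V))
  map_add' φ ψ := by
    ext V
    simp
  map_smul' t φ := by
    ext V
    simp only [Pi.smul_apply, RingHom.id_apply, ← smul_monomial]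
    rfl

theorem faceMonomials_apply (Δ : VertexComplex n) (φ : Finset (Fin n) → K) (V : Finset (Fin n)) :
    Δ.faceMonomials K φ V = Ideal.Quotient.mk _ (monomial (squarefreeVector V) (φ V)) :=
  rfl

theorem faceMonomials_apply_of_notMem {Δ : VertexComplex n} {V : Finset (Fin n)}
    (hV : V ∉ Δ.faces) (φ : Finset (Fin n) → K) : Δ.faceMonomials K φ V = 0 := by
  classical
  rw [faceMonomials_apply, Ideal.Quotient.eq_zero_iff_mem, mem_stanleyReisnerIdeal]
  intro a ha
  rw [coeff_monomial] at ha
  split_ifs at ha with h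
  · exact ⟨V, hV, h.le⟩
  · exact absurd rfl ha

theorem faceMonomials_apply_eq_zero {Δ : VertexComplex n} {V : Finset (Fin n)}
    (hV : V ∈ Δ.faces) {φ : Finset (Fin n) → K} (h : Δ.faceMonomials K φ V = 0) : φ V = 0 := by
  classical
  rw [faceMonomials_apply, Ideal.Quotient.eq_zero_iff_mem, mem_stanleyReisnerIdeal] at h
  by_contra hne
  obtain ⟨F, hF, hle⟩ := h (squarefreeVector V) (by rwa [coeff_monomial, if_pos rfl])
  exact hF (Δ.down_closed V hV F (squarefreeVector_le_iff.1 hle))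

variable (Δ : VertexComplex n) (W : Finset (Fin n))

theorem map_faceMonomials_chains (q : ℤ) :
    ((Δ.restrict W).chains K (q - 1)).map (Δ.faceMonomials K) =
      koszulCochains (fun V => Δ.ringGrading K (squarefreeVector V)) W q := by
  classical
  ext c
  constructor
  · rintro ⟨φ, hφ, rfl⟩ V
    refine ⟨mem_ringGrading.2 ⟨_, rfl⟩, fun hne => ?_⟩
    have h0 : φ V ≠ 0 := by
      intro h0
      rw [faceMonomials_apply, h0, map_zero, map_zero] at hne
      exact hne rfl
    exact ⟨(hφ V h0).1.2, by rw [(hφ V h0).2, sub_add_cancel]⟩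
  · intro hc
    choose φ hφ using fun V => mem_ringGrading.1 (hc V).1
    refine ⟨fun V => if c V = 0 then 0 else φ V, fun V hV => ?_, ?_⟩
    · have hne : c V ≠ 0 := fun h => hV (if_pos h)
      obtain ⟨hVW, hcard⟩ := (hc V).2 hne
      refine ⟨⟨?_, hVW⟩, by rw [hcard, sub_add_cancel]⟩
      by_contra hΔ
      exact hne ((hφ V).symm.trans (faceMonomials_apply_of_notMem hΔ φ))
    · ext V
      rw [faceMonomials_apply]
      by_cases h : c V = 0
      · rw [if_pos h, h, map_zero, map_zero]
      · rw [if_neg h, hφ]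

theorem finrank_map_faceMonomials {j : ℤ} {L : Submodule K (Finset (Fin n) → K)}
    (hL : L ≤ (Δ.restrict W).chains K j) :
    Module.finrank K (L.map (Δ.faceMonomials K)) = Module.finrank K L := by
  rw [← LinearMap.range_domRestrict, LinearMap.finrank_range_of_inj]
  rw [← LinearMap.ker_eq_bot, LinearMap.ker_eq_bot']
  rintro ⟨φ, hφ⟩ h0
  ext V
  by_contra hne
  exact hne (faceMonomials_apply_eq_zero (hL hφ V hne).1.1 (congrFun h0 V))

/-- Under the identification of faces with squarefree monomials, the Koszul differential is the
transpose of the simplicial boundary map. -/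
theorem koszulDiff_faceMonomials {q : ℤ} {φ : Finset (Fin n) → K}
    (hφ : φ ∈ (Δ.restrict W).chains K (q - 1)) :
    koszulDiff K _ W (Δ.faceMonomials K φ) =
      Δ.faceMonomials K (((Δ.restrict W).boundaryMatrix K q).transpose.mulVecLin φ) := by
  classical
  ext1 V
  rw [faceMonomials_apply, transpose_boundaryMatrix_mulVec]
  by_cases hVW : V ⊆ W
  swap
  · rw [koszulDiff_apply_of_not_subset hVW, if_neg fun h => hVW h.1.2, map_zero, map_zero]
  have hsum : koszulDiff K _ W (Δ.faceMonomials K φ) V = Ideal.Quotient.mk _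
      (monomial (squarefreeVector V)
        (∑ e ∈ V, (-1) ^ (V.filter (· < e)).card * φ (V.erase e))) := by
    rw [koszulDiff_apply_of_subset hVW, map_sum, map_sum]
    refine Finset.sum_congr rfl fun e he => ?_
    rw [faceMonomials_apply, ← smul_eq_mul, ← smul_monomial,
      ← single_add_squarefreeVector_erase he, ← one_mul (φ (V.erase e)), ← monomial_mul, one_mul]
    rfl
  rw [hsum]
  split_ifs with h
  · rfl
  by_cases hV : V ∈ Δ.faces
  · rw [Finset.sum_eq_zero]
    intro e he
    rw [mul_eq_zero_of_right]
    by_contra hne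
    have := (hφ _ hne).2
    refine h ⟨⟨hV, hVW⟩, ?_⟩
    rw [← Finset.card_erase_add_one he]
    push_cast
    omega
  · rw [map_zero, map_zero]
    exact faceMonomials_apply_of_notMem hV
      fun V => ∑ e ∈ V, (-1) ^ (V.filter (· < e)).card * φ (V.erase e)

theorem finrank_map_koszulDiff (q : ℤ) :
    Module.finrank K ((koszulCochains (fun V => Δ.ringGrading K (squarefreeVector V)) W q).map
      (koszulDiff K _ W)) = ((Δ.restrict W).boundaryMatrix K q).rank := by
  have : (koszulCochains (fun V => Δ.ringGrading K (squarefreeVector V)) W q).map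
      (koszulDiff K _ W) = (LinearMap.range
        ((Δ.restrict W).boundaryMatrix K q).transpose.mulVecLin).map (Δ.faceMonomials K) := by
    rw [← map_faceMonomials_chains, ← map_transpose_boundaryMatrix]
    ext c
    constructor
    · rintro ⟨_, ⟨φ, hφ, rfl⟩, rfl⟩
      exact ⟨_, ⟨φ, hφ, rfl⟩, (koszulDiff_faceMonomials Δ W hφ).symm⟩
    · rintro ⟨_, ⟨φ, hφ, rfl⟩, rfl⟩
      exact ⟨_, ⟨φ, hφ, rfl⟩, koszulDiff_faceMonomials Δ W hφ⟩
  rw [this, finrank_map_faceMonomials Δ W (range_transpose_boundaryMatrix_le _ q),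
    ← Matrix.rank_transpose]
  rfl

/-- The two complexes are transposes of each other, so that corresponding differentials have the
same rank; this gives the equality of dimensions, although one side is a cohomology. -/
theorem finrank_koszulCohomology_eq_reducedHomology (q : ℤ) :
    Module.finrank K (KoszulCohomology (fun V => Δ.ringGrading K (squarefreeVector V)) W q) =
      Module.finrank K ((Δ.restrict W).ReducedHomology K (q - 1)) := by
  have hfin : FiniteDimensional K
      (koszulCochains (fun V => Δ.ringGrading K (squarefreeVector V)) W q) := by
    rw [← map_faceMonomials_chains]
    infer_instance
  have hX : ∀ V, ∀ e ∈ V, ∀ x ∈ Δ.ringGrading K (squarefreeVector (V.erase e)),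
      (X e : MvPolynomial (Fin n) K) • x ∈ Δ.ringGrading K (squarefreeVector V) := by
    intro V e he x hx
    have := Δ.monomial_smul_mem_ringGrading (Finsupp.single e 1) (1 : K) _ x hx
    rwa [single_add_squarefreeVector_erase he] at this
  have h1 := finrank_quotient_add_add (koszulDiff K (Δ.StanleyReisnerRing K) W)
    (C := koszulCochains (fun V => Δ.ringGrading K (squarefreeVector V)) W q)
    (B := (koszulCochains (fun V => Δ.ringGrading K (squarefreeVector V)) W (q - 1)).map
      (koszulDiff K _ W)) (by
      rintro _ ⟨c, hc, rfl⟩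
      have := koszulDiff_mem hX hc
      rw [sub_add_cancel] at this
      exact ⟨this, koszulDiff_koszulDiff W c⟩)
  have h2 := finrank_quotient_add_add (boundary K n)
    (C := (Δ.restrict W).chains K (q - 1)) (B := (Δ.restrict W).boundaries K (q - 1)) (by
      rintro _ ⟨c, hc, rfl⟩
      exact ⟨boundary_mem_chains hc, boundary_boundary c⟩)
  have hd : Module.finrank K
      (koszulCochains (fun V => Δ.ringGrading K (squarefreeVector V)) W q) =
      Module.finrank K ((Δ.restrict W).chains K (q - 1)) := by
    rw [← map_faceMonomials_chains, finrank_map_faceMonomials Δ W le_rfl]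
  rw [finrank_map_koszulDiff, finrank_map_koszulDiff, hd] at h1
  have hb : Module.finrank K ((Δ.restrict W).boundaries K (q - 1)) =
      ((Δ.restrict W).boundaryMatrix K q).rank := by
    rw [boundaries, map_boundary_chains, sub_add_cancel]
    rfl
  have hc : Module.finrank K (((Δ.restrict W).chains K (q - 1)).map (boundary K n)) =
      ((Δ.restrict W).boundaryMatrix K (q - 1)).rank := by
    rw [map_boundary_chains]
    rfl
  rw [hb, hc] at h2
  change Module.finrank K (KoszulCohomology (fun V => Δ.ringGrading K (squarefreeVector V)) W q) +
    _ + _ = _ at h1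
  change Module.finrank K ((Δ.restrict W).ReducedHomology K (q - 1)) + _ + _ = _ at h2
  omega

end VertexComplex

end Duality

theorem corollary4p8 {K : Type*} [Field K] {n : ℕ} (Δ : VertexComplex n) :
    (∃ F : GradedFreeResolution (fineGrading K n) (Δ.ringGrading K), F.IsMinimal) ∧
    ∀ F : GradedFreeResolution (fineGrading K n) (Δ.ringGrading K), F.IsMinimal →
      ∀ (i : ℕ) (W : Finset (Fin n)),
        F.betti i (squarefreeVector W) =
          Module.finrank K
            (VertexComplex.ReducedHomology K (Δ.restrict W) ((W.card : ℤ) - (i : ℤ) - 1)) := by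
  refine ⟨Δ.exists_minimal_resolution, fun F hF i W => ?_⟩
  rw [← hF.finrank_koszulCohomology, Δ.finrank_koszulCohomology_eq_reducedHomology]
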